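/- Let $\mathcal{E}$ be an elementary topos (a cartesian closed category with finite limits and a subobject classifier; cocompleteness is not assumed). Suppose we are given: (1) an interval object with connections, i.e. an object $\mathbb{I}$ of $\mathcal{E}$ with a monomorphism $[\partial_0,\partial_1]\colon 1+1\to\mathbb{I}$ and maps $\wedge,\vee\colon \mathbb{I}\times\mathbb{I}\to\mathbb{I}$ satisfying (for generalised elements $i$ of $\mathbb{I}$, with $0,1$ standing for $\partial_0,\partial_1$) $$i\wedge 0=0\wedge i=0,\quad i\wedge 1=1\wedge i=i,\quad i\vee 0=0\vee i=i,\quad i\vee 1=1\vee i=1;$$ (2) a class $\mathcal{C}$ of monomorphisms of $\mathcal{E}$ such that (a) $\mathcal{C}$ is a dominance: it contains all isomorphisms, is closed under composition and under pullback along arbitrary maps, and the category whose objects are the maps in $\mathcal{C}$ and whose morphisms are the pullback squares between them has a terminal object; (b) $\mathcal{C}$ is closed under finite unions of subobjects, including the empty union; (c) $[\partial_0,\partial_1]\colon 1+1\to\mathbb{I}$ belongs to $\mathcal{C}$. For maps $f\colon A\to B$ and $u\colon X\to Y$ of $\mathcal{E}$, let $f\mathbin{\hat\otimes}u\colon (B\times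 X)\cup_{A\times X}(A\times Y)\to B\times Y$ denote the Leibniz product (pushout product). Call a map of $\mathcal{E}$ a fibration if it has the right lifting property with respect to all maps $\partial_i\mathbin{\hat\otimes}u$ with $u\in\mathcal{C}$ and $i\in\{0,1\}$; call an object $X$ fibrant if $X\to 1$ is a fibration, and let $\mathcal{E}_f$ be the full subcategory of $\mathcal{E}$ on the fibrant objects. Call $f,g\colon B\to A$ homotopic, $f\simeq g$, if there is a map $H\colon\mathbb{I}\times B\to A$ in $\mathcal{E}$ with $H(\partial_0\times B)=f$ and $H(\partial_1\times B)=g$; call $f\colon B\to A$ a homotopy equivalence if there is $g\colon A\to B$ with $gf\simeq 1_B$ and $fg\simeq 1_A$. Let $\mathsf{Cof}$, $\mathsf{Fib}$ and $\mathsf{W}$ be the classes of maps of $\mathcal{E}_f$ that, as maps of $\mathcal{E}$, belong to $\mathcal{C}$, are fibrations, and are homotopy equivalences, respectively. Then $(\mathsf{Cof},\mathsf{Fib},\mathsf{W})$ is a Quillen model structure on $\mathcal{E}_f$, in the following sense: $(\mathsf{Cof}\cap\mathsf{W},\mathsf{Fib})$ and $(\mathsf{Cof},\mathsf{Fib}\cap\mathsf{W})$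 are weak factorisation systems on $\mathcal{E}_f$, and $\mathsf{W}$ satisfies 2-out-of-3. (Here $(\mathcal{L},\mathcal{R})$ is a weak factorisation system if every map factors as a map in $\mathcal{L}$ followed by a map in $\mathcal{R}$, $\mathcal{R}$ is the class of maps with the right lifting property against $\mathcal{L}$, and $\mathcal{L}$ is the class of maps with the left lifting property against $\mathcal{R}$.) -/

import Mathlib

open CategoryTheory Limits MonoidalCategory CartesianMonoidalCategory

universe v u

namespace IntervalModel

/-- A Quillen model structure on a category: three classes of maps such that
`(Cof ∩ W, Fib)` and `(Cof, Fib ∩ W)` are weak factorisation systems and `W` satisfies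
2-out-of-3. No limits or colimits are required of the category. -/
structure IsQuillenModelStructure {D : Type u} [Category.{v} D]
    (Cof Fib W : MorphismProperty D) : Prop where
  trivCof_fib : MorphismProperty.IsWeakFactorizationSystem (Cof ⊓ W) Fib
  cof_trivFib : MorphismProperty.IsWeakFactorizationSystem Cof (Fib ⊓ W)
  twoOutOfThree : W.HasTwoOutOfThreeProperty

/-- A class of monomorphisms `S` is a dominance if it contains the isomorphisms, is closed under
composition and pullback, and the category whose objects are the maps in `S` and whose morphisms
are the pullback squares between them has a terminal object `m`. -/
structure IsDominance {E : Type u} [Category.{v} E] (S : MorphismProperty E) : Prop where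
  mono : S ≤ MorphismProperty.monomorphisms E
  iso : MorphismProperty.isomorphisms E ≤ S
  comp : S.IsStableUnderComposition
  pullback : S.IsStableUnderBaseChange
  exists_terminal : ∃ (A B : E) (m : A ⟶ B), S m ∧
    ∀ (X Y : E) (f : X ⟶ Y), S f →
      ∃! p : (X ⟶ A) × (Y ⟶ B), IsPullback p.1 f m p.2

/-- `S` is closed under finite unions of subobjects: if the members of a finite (possibly empty)
set of subobjects of `X` are represented by maps in `S`, so is their union, that is, their least
upper bound in the poset of subobjects of `X`. -/
def IsClosedUnderFiniteUnions {E : Type u} [Category.{v} E] (S : MorphismProperty E) : Prop :=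
  ∀ (X : E) (s : Set (Subobject X)), s.Finite → (∀ a ∈ s, S a.arrow) →
    ∀ t : Subobject X, IsLUB s t → S t.arrow

variable {E : Type u} [Category.{v} E] [CartesianMonoidalCategory E]

variable (E) in
/-- An interval object with connections: an object `I` with a monomorphism `1 + 1 ⟶ I`, and
two binary operations `∧`, `∨` on `I` satisfying
`i ∧ 0 = 0 = 0 ∧ i`, `i ∧ 1 = i = 1 ∧ i`, `i ∨ 0 = i = 0 ∨ i`, `i ∨ 1 = 1 = 1 ∨ i`. -/
structure IntervalObject where
  /-- the interval -/
  I : E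
  /-- a coproduct `1 + 1` -/
  ends : BinaryCofan (𝟙_ E) (𝟙_ E)
  isColimit : IsColimit ends
  /-- the inclusion `[∂₀, ∂₁] : 1 + 1 ⟶ I` of the endpoints -/
  incl : ends.pt ⟶ I
  mono_incl : Mono incl
  /-- the connection `∧` -/
  meet : I ⊗ I ⟶ I
  /-- the connection `∨` -/
  join : I ⊗ I ⟶ I
  meet_zero : lift (𝟙 I) (toUnit I ≫ ends.inl ≫ incl) ≫ meet = toUnit I ≫ ends.inl ≫ incl
  zero_meet : lift (toUnit I ≫ ends.inl ≫ incl) (𝟙 I) ≫ meet = toUnit I ≫ ends.inl ≫ incl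
  meet_one : lift (𝟙 I) (toUnit I ≫ ends.inr ≫ incl) ≫ meet = 𝟙 I
  one_meet : lift (toUnit I ≫ ends.inr ≫ incl) (𝟙 I) ≫ meet = 𝟙 I
  join_zero : lift (𝟙 I) (toUnit I ≫ ends.inl ≫ incl) ≫ join = 𝟙 I
  zero_join : lift (toUnit I ≫ ends.inl ≫ incl) (𝟙 I) ≫ join = 𝟙 I
  join_one : lift (𝟙 I) (toUnit I ≫ ends.inr ≫ incl) ≫ join = toUnit I ≫ ends.inr ≫ incl
  one_join : lift (toUnit I ≫ ends.inr ≫ incl) (𝟙 I) ≫ join = toUnit I ≫ ends.inr ≫ incl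

namespace IntervalObject

variable (J : IntervalObject E)

/-- The endpoint `∂₀ : 1 ⟶ I`. -/
def d0 : 𝟙_ E ⟶ J.I := J.ends.inl ≫ J.incl

/-- The endpoint `∂₁ : 1 ⟶ I`. -/
def d1 : 𝟙_ E ⟶ J.I := J.ends.inr ≫ J.incl

/-- The map `∂₀ × B : B ⟶ I × B`. -/
def atZero (B : E) : B ⟶ J.I ⊗ B := lift (toUnit B ≫ J.d0) (𝟙 B)

/-- The map `∂₁ × B : B ⟶ I × B`. -/
def atOne (B : E) : B ⟶ J.I ⊗ B := lift (toUnit B ≫ J.d1) (𝟙 B)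

/-- Two parallel maps `f g : B ⟶ A` are homotopic if there is `H : I × B ⟶ A` that restricts to
`f` at `∂₀` and to `g` at `∂₁`. -/
def Homotopic {B A : E} (f g : B ⟶ A) : Prop :=
  ∃ H : J.I ⊗ B ⟶ A, f = J.atZero B ≫ H ∧ g = J.atOne B ≫ H

/-- The class of homotopy equivalences. -/
def homotopyEquivalences : MorphismProperty E := fun B A f =>
  ∃ g : A ⟶ B, J.Homotopic (f ≫ g) (𝟙 B) ∧ J.Homotopic (g ≫ f) (𝟙 A)

/-- The maps `∂ᵢ ⊗̂ u`, for `u ∈ S` and `i = 0, 1`, where `⊗̂` is the Leibniz product (pushout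
product) with respect to the cartesian product. Here `sq.ι` is the Leibniz product computed from a
pushout `sq.pt` of `I × X` and `1 × Y` over `1 × X`. -/
inductive LeibnizMaps (S : MorphismProperty E) : MorphismProperty E
  | zero {X Y : E} (w : X ⟶ Y) (hw : S w) (sq : (curriedTensor E).PushoutObjObj J.d0 w) :
      LeibnizMaps S sq.ι
  | one {X Y : E} (w : X ⟶ Y) (hw : S w) (sq : (curriedTensor E).PushoutObjObj J.d1 w) :
      LeibnizMaps S sq.ι

/-- The fibrations: the maps with the right lifting property against all `∂ᵢ ⊗̂ u`, `u ∈ S`. -/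
def fibrations (S : MorphismProperty E) : MorphismProperty E := (J.LeibnizMaps S).rlp

/-- The fibrant objects: those `X` for which `X ⟶ 1` is a fibration. -/
def fibrant (S : MorphismProperty E) : ObjectProperty E := fun X => J.fibrations S (toUnit X)

end IntervalObject

end IntervalModel

set_option linter.unusedSectionVars false

/-! The maps with the right lifting property against `S` play the role of trivial fibrations. As `S`
is a dominance, the partial maps over an object with domain in `S` are classified by an object over
it; inserting this classifier factors every map as a map in `S` followed by one in `S.rlp`
(`IsDominance.exists_factorization`). No small object argument occurs. Closure of `S` under unions
puts the Leibniz products of endpoints with cofibrations in `S`, so maps in `S.rlp` are fibrations;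
lifting against (1 + 1) × X ⟶ I × X makes them homotopy equivalences.

In a fibrant object, two-dimensional open boxes relative to a cofibration can be filled
(`exists_filling`). This makes homotopy an equivalence relation, whence 2-out-of-3, and makes a
cofibration that is a homotopy equivalence a strong deformation retract
(`exists_strongDeformationRetraction`), which therefore lifts against fibrations. For the other
factorisation, the mapping path object writes a map as a section of a trivial fibration followed by
a fibration; factoring the section through `S` turns it into a trivial cofibration. A retract
argument shows that fibrations between fibrant objects that are homotopy equivalences lie in
`S.rlp`.

The few pushouts needed are unions of subobjects. They are constructed, and shown to be effective,
by impredicative internal logic with power objects. -/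

namespace IntervalModel

/-! ### Internal logic: truth values and comprehension of predicates on generalised elements. -/

section Topos

open HasSubobjectClassifier

variable {E : Type u} [Category.{v} E] [HasSubobjectClassifier E]

/-- A generalised truth value is true if it factors through `truth`. -/
def IsTrue {W : E} (t : W ⟶ Ω E) : Prop := ∃ l : W ⟶ Ω₀ E, l ≫ truth E = t

lemma IsTrue.comp {W W' : E} {t : W ⟶ Ω E} (h : IsTrue t) (f : W' ⟶ W) : IsTrue (f ≫ t) := by
  obtain ⟨l, rfl⟩ := h
  exact ⟨f ≫ l, by simp⟩

/-- The generalised truth value constantly equal to true. -/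
noncomputable def top (W : E) : W ⟶ Ω E := Subobject.Classifier.χ₀ _ W ≫ truth E

lemma comp_top {W W' : E} (f : W' ⟶ W) : f ≫ top W = top W' := by
  rw [top, top, ← Category.assoc]
  congr 1
  exact Subobject.Classifier.isTerminalΩ₀.hom_ext _ _

lemma isTrue_iff {W : E} (t : W ⟶ Ω E) : IsTrue t ↔ t = top W := by
  constructor
  · rintro ⟨l, rfl⟩
    rw [top]
    congr 1
    exact Subobject.Classifier.isTerminalΩ₀.hom_ext _ _
  · rintro rfl
    exact ⟨_, rfl⟩

lemma isTrue_comp_χ_iff {U Z W : E} (m : U ⟶ Z) [Mono m] (w : W ⟶ Z) :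
    IsTrue (w ≫ χ m) ↔ ∃ l, l ≫ m = w := by
  constructor
  · rintro ⟨l, hl⟩
    exact ⟨(isPullback_χ m).lift w l hl.symm, IsPullback.lift_fst _ _ _ _⟩
  · rintro ⟨l, rfl⟩
    rw [Category.assoc, HasSubobjectClassifier.comm]
    exact ⟨l ≫ Subobject.Classifier.χ₀ _ U, by simp⟩

variable [HasPullbacks E]

lemma exists_eq_χ {Z : E} (t : Z ⟶ Ω E) : ∃ (U : E) (m : U ⟶ Z) (_ : Mono m), t = χ m :=
  Subobject.Classifier.surjective_χ _ t

/-- The inclusions of the two classified subobjects are themselves generalised elements; testing on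
them makes the subobjects factor through each other. -/
lemma truthValue_ext {Z : E} {s t : Z ⟶ Ω E}
    (h : ∀ ⦃W : E⦄ (w : W ⟶ Z), IsTrue (w ≫ s) ↔ IsTrue (w ≫ t)) : s = t := by
  obtain ⟨U, m, _, rfl⟩ := exists_eq_χ s
  obtain ⟨V, n, _, rfl⟩ := exists_eq_χ t
  simp only [isTrue_comp_χ_iff] at h
  obtain ⟨l, hl⟩ := (h m).1 ⟨𝟙 _, by simp⟩
  obtain ⟨k, hk⟩ := (h n).2 ⟨𝟙 _, by simp⟩
  have hlk : l ≫ k = 𝟙 _ := by rw [← cancel_mono m]; simp [hk, hl]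
  have hkl : k ≫ l = 𝟙 _ := by rw [← cancel_mono n]; simp [hk, hl]
  let e : U ≅ V := ⟨l, k, hlk, hkl⟩
  refine unique n _ ?_
  refine (isPullback_χ m).of_iso e (Iso.refl _) (Iso.refl _) (Iso.refl _) ?_ ?_ ?_ ?_
  · simp [e, hl]
  · exact Subobject.Classifier.isTerminalΩ₀.hom_ext _ _
  · simp
  · simp

/-- A predicate on the generalised elements of `Z` is comprehensible if it is membership in
a subobject of `Z`. -/
def IsComprehensible {Z : E} (P : ∀ ⦃W : E⦄, (W ⟶ Z) → Prop) : Prop :=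
  ∃ t : Z ⟶ Ω E, ∀ ⦃W : E⦄ (w : W ⟶ Z), P w ↔ IsTrue (w ≫ t)

namespace IsComprehensible

variable {Z : E} {P Q : ∀ ⦃W : E⦄, (W ⟶ Z) → Prop}

lemma of_mono {K : E} (k : K ⟶ Z) [Mono k] : IsComprehensible fun _ w ↦ ∃ l, l ≫ k = w :=
  ⟨χ k, fun _ w ↦ (isTrue_comp_χ_iff k w).symm⟩

lemma exists_mono (h : IsComprehensible P) :
    ∃ (K : E) (k : K ⟶ Z), Mono k ∧ ∀ ⦃W : E⦄ (w : W ⟶ Z), P w ↔ ∃ l, l ≫ k = w := by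
  obtain ⟨t, ht⟩ := h
  obtain ⟨K, k, hk, rfl⟩ := exists_eq_χ t
  exact ⟨K, k, hk, fun _ w ↦ (ht w).trans (isTrue_comp_χ_iff k w)⟩

lemma congr (h : IsComprehensible P) (hPQ : ∀ ⦃W : E⦄ (w : W ⟶ Z), P w ↔ Q w) :
    IsComprehensible Q := by
  obtain ⟨t, ht⟩ := h
  exact ⟨t, fun _ w ↦ (hPQ w).symm.trans (ht w)⟩

lemma isTrue (t : Z ⟶ Ω E) : IsComprehensible fun _ w ↦ IsTrue (w ≫ t) := ⟨t, fun _ _ ↦ Iff.rfl⟩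

lemma comp (h : IsComprehensible P) {Z' : E} (f : Z' ⟶ Z) :
    IsComprehensible fun _ (w : _ ⟶ Z') ↦ P (w ≫ f) := by
  obtain ⟨t, ht⟩ := h
  exact ⟨f ≫ t, fun _ w ↦ by rw [← Category.assoc]; exact ht _⟩

lemma restrict (h : IsComprehensible P) {W W' : E} {w : W ⟶ Z} (hw : P w) (f : W' ⟶ W) :
    P (f ≫ w) := by
  obtain ⟨t, ht⟩ := h
  rw [ht] at hw ⊢
  rw [Category.assoc]
  exact hw.comp f

lemma and (hP : IsComprehensible P) (hQ : IsComprehensible Q) :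
    IsComprehensible fun _ w ↦ P w ∧ Q w := by
  obtain ⟨K, k, _, hk⟩ := hP.exists_mono
  obtain ⟨L, l, _, hl⟩ := hQ.exists_mono
  refine (of_mono (pullback.fst k l ≫ k)).congr fun W w ↦ ?_
  rw [hk, hl]
  constructor
  · rintro ⟨r, rfl⟩
    exact ⟨⟨r ≫ pullback.fst _ _, by simp⟩, ⟨r ≫ pullback.snd _ _, by simp [pullback.condition]⟩⟩
  · rintro ⟨⟨a, rfl⟩, ⟨b, hb⟩⟩
    exact ⟨pullback.lift a b hb.symm, pullback.lift_fst_assoc _ _ _ _⟩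

variable [HasEqualizers E]

lemma eq {Y : E} (a b : Z ⟶ Y) : IsComprehensible fun _ w ↦ w ≫ a = w ≫ b := by
  refine (of_mono (equalizer.ι a b)).congr fun W w ↦ ?_
  constructor
  · rintro ⟨r, rfl⟩
    rw [Category.assoc, Category.assoc, equalizer.condition]
  · exact fun h ↦ ⟨equalizer.lift w h, by simp⟩

/-- P implies Q exactly where P and P ∧ Q have the same truth value, so the implication is
comprehended by an equaliser. -/
lemma imp (hP : IsComprehensible P) (hQ : IsComprehensible Q) :
    IsComprehensible fun W w ↦ ∀ ⦃V : E⦄ (f : V ⟶ W), P (f ≫ w) → Q (f ≫ w) := by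
  obtain ⟨s, hs⟩ := hP
  obtain ⟨t, ht⟩ := IsComprehensible.and ⟨s, hs⟩ hQ
  refine (eq s t).congr fun W w ↦ ⟨fun h V f hf ↦ ?_, fun h ↦ truthValue_ext fun V f ↦ ?_⟩
  · rw [hs, Category.assoc, h, ← Category.assoc, ← ht] at hf
    exact hf.2
  · rw [← Category.assoc, ← Category.assoc, ← hs, ← ht]
    exact ⟨fun hf ↦ ⟨hf, h f hf⟩, fun hf ↦ hf.1⟩

variable [CartesianMonoidalCategory E] [MonoidalClosed E]

/-- A truth value on X × W is everywhere true iff its transpose equals that of the constant true,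
which is again an equaliser condition. This is the universal quantifier over X. -/
lemma forall_tensor {X : E} {R : ∀ ⦃W : E⦄, (W ⟶ X ⊗ Z) → Prop} (h : IsComprehensible R) :
    IsComprehensible fun _ (w : _ ⟶ Z) ↦ R (X ◁ w) := by
  obtain ⟨t, ht⟩ := h
  refine (eq (MonoidalClosed.curry t) (MonoidalClosed.curry (top _))).congr fun W w ↦ ?_
  rw [ht, isTrue_iff, ← MonoidalClosed.curry_natural_left, ← MonoidalClosed.curry_natural_left,
    MonoidalClosed.curry_injective.eq_iff, comp_top]

lemma forall_lift {X : E} {R : ∀ ⦃W : E⦄, (W ⟶ X ⊗ Z) → Prop} (h : IsComprehensible R) :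
    IsComprehensible fun W (w : _ ⟶ Z) ↦ ∀ ⦃V : E⦄ (f : V ⟶ W) (x : V ⟶ X),
      R (lift x (f ≫ w)) := by
  refine h.forall_tensor.congr fun W w ↦ ⟨fun hw V f x ↦ ?_, fun hw ↦ ?_⟩
  · simpa using h.restrict hw (lift x f)
  · convert! hw (snd X W) (fst X W)
    ext <;> simp

end IsComprehensible

end Topos

/-! ### Unions of subobjects, their effectiveness, and the initial object. -/

section Colimits

open HasSubobjectClassifier

variable {E : Type u} [Category.{v} E] [CartesianMonoidalCategory E] [HasFiniteLimits E]
  [MonoidalClosed E] [HasSubobjectClassifier E]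

lemma IsComprehensible.forall_isTrue {U Z : E} (u : U ⟶ Z) [Mono u] (a : U ⟶ Ω E) :
    IsComprehensible fun W (w : W ⟶ Z) ↦
      ∀ ⦃V : E⦄ (f : V ⟶ W) (l : V ⟶ U), l ≫ u = f ≫ w → IsTrue (l ≫ a) := by
  obtain ⟨A, m, _, rfl⟩ := exists_eq_χ a
  refine ((of_mono u).imp (of_mono (m ≫ u))).congr fun W w ↦ ?_
  refine forall_congr' fun V ↦ forall_congr' fun f ↦ ?_
  constructor
  · intro h l hl
    obtain ⟨k, hk⟩ := h ⟨l, hl⟩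
    rw [isTrue_comp_χ_iff]
    exact ⟨k, by rw [← cancel_mono u, Category.assoc, hk, hl]⟩
  · rintro h ⟨l, hl⟩
    obtain ⟨k, hk⟩ := (isTrue_comp_χ_iff _ _).1 (h l hl)
    exact ⟨k, by rw [← Category.assoc, hk, hl]⟩

/-- Truth values on two subobjects that agree on the intersection extend to the ambient object. -/
lemma exists_truthValue_extension {U V Z : E} (u : U ⟶ Z) (v : V ⟶ Z) [Mono u] [Mono v]
    (a : U ⟶ Ω E) (b : V ⟶ Ω E)
    (h : ∀ ⦃W : E⦄ (f : W ⟶ U) (g : W ⟶ V), f ≫ u = g ≫ v → f ≫ a = g ≫ b) :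
    ∃ c : Z ⟶ Ω E, u ≫ c = a ∧ v ≫ c = b := by
  -- The extension is c(z) = (z ∈ U ⇒ a) ∧ (z ∈ V ⇒ b); agreement on the intersection makes the
  -- second conjunct harmless on U, and the first on V.
  obtain ⟨c, hc⟩ := (IsComprehensible.forall_isTrue u a).and (IsComprehensible.forall_isTrue v b)
  refine ⟨c, truthValue_ext fun W w ↦ ?_, truthValue_ext fun W w ↦ ?_⟩
  · rw [← Category.assoc, ← hc]
    constructor
    · intro hw
      simpa using hw.1 (𝟙 _) w (by simp)
    · intro hw
      refine ⟨fun V' f l hl ↦ ?_, fun V' f l hl ↦ ?_⟩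
      · obtain rfl : l = f ≫ w := by rw [← cancel_mono u, hl, Category.assoc]
        simpa using hw.comp f
      · rw [← h (f ≫ w) l (by simp [hl])]
        simpa using hw.comp f
  · rw [← Category.assoc, ← hc]
    constructor
    · intro hw
      simpa using hw.2 (𝟙 _) w (by simp)
    · intro hw
      refine ⟨fun V' f l hl ↦ ?_, fun V' f l hl ↦ ?_⟩
      · rw [h l (f ≫ w) (by simp [hl])]
        simpa using hw.comp f
      · obtain rfl : l = f ≫ w := by rw [← cancel_mono v, hl, Category.assoc]
        simpa using hw.comp f

/-- The equality predicate on `X`. -/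
noncomputable def equality (X : E) : X ⊗ X ⟶ Ω E :=
  have : Mono (lift (𝟙 X) (𝟙 X)) := mono_of_mono_fac (lift_fst (𝟙 X) (𝟙 X))
  χ (lift (𝟙 X) (𝟙 X))

lemma isTrue_lift_equality_iff {W X : E} (x y : W ⟶ X) :
    IsTrue (lift x y ≫ equality X) ↔ x = y := by
  have : Mono (lift (𝟙 X) (𝟙 X)) := mono_of_mono_fac (lift_fst (𝟙 X) (𝟙 X))
  rw [equality, isTrue_comp_χ_iff]
  constructor
  · rintro ⟨l, hl⟩
    have h1 := congr($hl ≫ fst _ _)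
    have h2 := congr($hl ≫ snd _ _)
    simp only [comp_lift, Category.comp_id, lift_fst, lift_snd] at h1 h2
    rw [← h1, h2]
  · rintro rfl
    exact ⟨x, by simp⟩

/-- The singleton map from `X` to its power object. -/
noncomputable def singleton (X : E) : X ⟶ (ihom X).obj (Ω E) := MonoidalClosed.curry (equality X)

lemma lift_comp_curry_ev {W X Y Z : E} (x : W ⟶ X) (z : W ⟶ Z) (t : X ⊗ Z ⟶ Y) :
    lift x (z ≫ MonoidalClosed.curry t) ≫ (ihom.ev X).app Y = lift x z ≫ t := by
  have : lift x (z ≫ MonoidalClosed.curry t) = lift x z ≫ X ◁ MonoidalClosed.curry t := by simp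
  rw [this, Category.assoc, MonoidalClosed.whiskerLeft_curry_ihom_ev_app]

instance (X : E) : Mono (singleton X) where
  right_cancellation {W} x y h := by
    have := congr(lift x (𝟙 W) ≫ X ◁ $h ≫ (ihom.ev X).app _)
    simp only [lift_whiskerLeft_assoc, Category.id_comp, singleton, lift_comp_curry_ev] at this
    rw [← isTrue_lift_equality_iff, ← this, isTrue_lift_equality_iff]

lemma comp_curry_eq_iff {W X Z Z' : E} (w : W ⟶ Z) (w' : W ⟶ Z') (s : X ⊗ Z ⟶ Ω E)
    (t : X ⊗ Z' ⟶ Ω E) :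
    w ≫ MonoidalClosed.curry s = w' ≫ MonoidalClosed.curry t ↔
      ∀ ⦃V : E⦄ (x : V ⟶ X) (y : V ⟶ W),
        IsTrue (lift x (y ≫ w) ≫ s) ↔ IsTrue (lift x (y ≫ w') ≫ t) := by
  rw [← MonoidalClosed.curry_natural_left, ← MonoidalClosed.curry_natural_left,
    MonoidalClosed.curry_injective.eq_iff]
  constructor
  · intro h V x y
    have := congr(lift x y ≫ $h)
    simp only [lift_whiskerLeft_assoc] at this
    rw [this]
  · intro h
    refine truthValue_ext fun V v ↦ ?_
    have := h (v ≫ fst _ _) (v ≫ snd _ _)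
    have key : ∀ ⦃Y : E⦄ (z : W ⟶ Y),
        lift (v ≫ fst _ _) ((v ≫ snd _ _) ≫ z) = v ≫ X ◁ z := fun Y z ↦ by ext <;> simp
    rwa [key, key, Category.assoc, Category.assoc] at this

/-- Any two subobjects have a union. -/
lemma exists_union {U V Z : E} (u : U ⟶ Z) (v : V ⟶ Z) [Mono u] [Mono v] :
    ∃ (T : E) (t : T ⟶ Z) (u' : U ⟶ T) (v' : V ⟶ T), Mono t ∧ u' ≫ t = u ∧ v' ≫ t = v ∧
      ∀ ⦃K : E⦄ (k : K ⟶ Z), Mono k → (∃ l, l ≫ k = u) → (∃ l, l ≫ k = v) →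
        ∃ l, l ≫ k = t := by
  -- Impredicative disjunction: z lies in the union iff every truth value p implied by both z ∈ U
  -- and z ∈ V is true.
  have hp := IsComprehensible.isTrue (E := E) (fst (Ω E) Z)
  have hu := ((IsComprehensible.of_mono u).comp (snd (Ω E) Z)).imp hp
  have hv := ((IsComprehensible.of_mono v).comp (snd (Ω E) Z)).imp hp
  obtain ⟨T, t, _, ht⟩ := ((hu.and hv).imp hp).forall_lift.exists_mono
  obtain ⟨u', hu'⟩ := (ht u).1 fun V f p V' g hg ↦ by
    have := hg.1 (𝟙 _) ⟨g ≫ f, by simp⟩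
    simpa using this
  obtain ⟨v', hv'⟩ := (ht v).1 fun V f p V' g hg ↦ by
    have := hg.2 (𝟙 _) ⟨g ≫ f, by simp⟩
    simpa using this
  refine ⟨T, t, u', v', inferInstance, hu', hv', fun K k _ ⟨a, ha⟩ ⟨b, hb⟩ ↦ ?_⟩
  have h := (ht t).2 ⟨𝟙 _, by simp⟩ (𝟙 _) (t ≫ χ k) (𝟙 _) ⟨fun V f ⟨l, hl⟩ ↦ ?_,
    fun V f ⟨l, hl⟩ ↦ ?_⟩
  · rw [← isTrue_comp_χ_iff]
    simpa using h
  · have : f ≫ t = l ≫ u := by simpa using hl.symm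
    have h' : IsTrue ((f ≫ t) ≫ χ k) := (isTrue_comp_χ_iff _ _).2 ⟨l ≫ a, by rw [this]; simp [ha]⟩
    simpa using h'
  · have : f ≫ t = l ≫ v := by simpa using hl.symm
    have h' : IsTrue ((f ≫ t) ≫ χ k) := (isTrue_comp_χ_iff _ _).2 ⟨l ≫ b, by rw [this]; simp [hb]⟩
    simpa using h'

instance mono_whiskerLeft {X Y : E} (K : E) (f : X ⟶ Y) [Mono f] : Mono (K ◁ f) where
  right_cancellation g h w := by
    ext
    · simpa using congr($w ≫ fst _ _)
    · rw [← cancel_mono f]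
      simpa using congr($w ≫ snd _ _)

/-- Unions of subobjects are effective: they are pushouts of the intersection. -/
lemma isPushout_of_isUnion {I U V Z T : E} {f : I ⟶ U} {g : I ⟶ V} {u : U ⟶ Z} {v : V ⟶ Z}
    [Mono u] [Mono v] (sq : IsPullback f g u v) {t : T ⟶ Z} [Mono t] {u' : U ⟶ T} {v' : V ⟶ T}
    (hu : u' ≫ t = u) (hv : v' ≫ t = v)
    (h : ∀ ⦃K : E⦄ (k : K ⟶ Z), Mono k → (∃ l, l ≫ k = u) → (∃ l, l ≫ k = v) →
      ∃ l, l ≫ k = t) : IsPushout f g u' v' := by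
  have : Mono u' := mono_of_mono_fac hu
  have : Mono v' := mono_of_mono_fac hv
  have w : f ≫ u' = g ≫ v' := by rw [← cancel_mono t]; simp [hu, hv, sq.w]
  have h' : ∀ ⦃K : E⦄ (k : K ⟶ T) (_ : Mono k), (∃ l, l ≫ k = u') → (∃ l, l ≫ k = v') →
      ∃ l, l ≫ k = 𝟙 T := by
    rintro K k _ ⟨a, ha⟩ ⟨b, hb⟩
    obtain ⟨l, hl⟩ := h (k ≫ t) inferInstance ⟨a, by rw [← hu, ← ha]; simp⟩
      ⟨b, by rw [← hv, ← hb]; simp⟩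
    exact ⟨l, by rw [← cancel_mono t]; simp [hl]⟩
  have hext : ∀ ⦃X : E⦄ (c c' : T ⟶ X), u' ≫ c = u' ≫ c' → v' ≫ c = v' ≫ c' → c = c' := by
    intro X c c' h1 h2
    obtain ⟨l, hl⟩ := h' (equalizer.ι c c') inferInstance ⟨equalizer.lift u' h1, equalizer.lift_ι _ _⟩
      ⟨equalizer.lift v' h2, equalizer.lift_ι _ _⟩
    rw [← Category.id_comp c, ← Category.id_comp c', ← hl, Category.assoc, Category.assoc,
      equalizer.condition]
  have hdesc : ∀ ⦃X : E⦄ (a : U ⟶ X) (b : V ⟶ X), f ≫ a = g ≫ b →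
      ∃ c : T ⟶ X, u' ≫ c = a ∧ v' ≫ c = b := by
    intro X a b hab
    -- R is the graph of the desired map: the relations a(z) = x on U and b(z) = x on V are glued to
    -- a relation between X and T.
    obtain ⟨R, hR₁, hR₂⟩ := exists_truthValue_extension (X ◁ u') (X ◁ v')
      (X ◁ a ≫ equality X) (X ◁ b ≫ equality X) (by
        intro W p q hpq
        have h1 : p ≫ fst _ _ = q ≫ fst _ _ := by simpa using congr($hpq ≫ fst _ _)
        have h2 : (p ≫ snd _ _) ≫ u = (q ≫ snd _ _) ≫ v := by
          rw [← hu, ← hv]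
          simpa using congr($hpq ≫ snd _ _ ≫ t)
        rw [← Category.assoc, ← Category.assoc]
        congr 1
        ext
        · simpa using h1
        · obtain ⟨r, e1, e2⟩ := sq.exists_lift _ _ h2
          simp only [Category.assoc, whiskerLeft_snd]
          rw [← Category.assoc, ← Category.assoc, ← e1, ← e2, Category.assoc, hab,
            Category.assoc])
    have hR₁' : u' ≫ MonoidalClosed.curry R = a ≫ singleton X := by
      rw [singleton, ← MonoidalClosed.curry_natural_left, ← MonoidalClosed.curry_natural_left, hR₁]
    have hR₂' : v' ≫ MonoidalClosed.curry R = b ≫ singleton X := by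
      rw [singleton, ← MonoidalClosed.curry_natural_left, ← MonoidalClosed.curry_natural_left, hR₂]
    -- The points of T over which R is a singleton form a subobject containing U and V, hence all of
    -- T; so R is the graph of a map.
    obtain ⟨l, hl⟩ := h' (pullback.fst (MonoidalClosed.curry R) (singleton X)) inferInstance
      ⟨pullback.lift u' a hR₁', pullback.lift_fst _ _ _⟩
      ⟨pullback.lift v' b hR₂', pullback.lift_fst _ _ _⟩
    have hc : (l ≫ pullback.snd _ _) ≫ singleton X = MonoidalClosed.curry R := by
      rw [Category.assoc, ← pullback.condition, ← Category.assoc, hl, Category.id_comp]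
    refine ⟨l ≫ pullback.snd _ _, ?_, ?_⟩
    · rw [← cancel_mono (singleton X), Category.assoc, hc, hR₁']
    · rw [← cancel_mono (singleton X), Category.assoc, hc, hR₂']
  exact ⟨⟨w⟩, ⟨PushoutCocone.IsColimit.mk w
    (fun s ↦ (hdesc s.inl s.inr s.condition).choose)
    (fun s ↦ (hdesc s.inl s.inr s.condition).choose_spec.1)
    (fun s ↦ (hdesc s.inl s.inr s.condition).choose_spec.2)
    (fun s m h1 h2 ↦ hext _ _
      (h1.trans (hdesc s.inl s.inr s.condition).choose_spec.1.symm)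
      (h2.trans (hdesc s.inl s.inr s.condition).choose_spec.2.symm))⟩⟩

/-- An object is void if all truth values over it are true. -/
def IsVoid (W : E) : Prop := ∀ ⦃V : E⦄ (_ : V ⟶ W) (p : V ⟶ Ω E), IsTrue p

lemma IsVoid.of_hom {W W' : E} (h : IsVoid W) (f : W' ⟶ W) : IsVoid W' :=
  fun _ g p ↦ h (g ≫ f) p

lemma IsVoid.exists_section {K W : E} (h : IsVoid W) (k : K ⟶ W) [Mono k] :
    ∃ l, l ≫ k = 𝟙 W :=
  (isTrue_comp_χ_iff _ _).1 (h (𝟙 W) _)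

lemma IsVoid.hom_ext {W X : E} (h : IsVoid W) (f g : W ⟶ X) : f = g := by
  obtain ⟨l, hl⟩ := h.exists_section (equalizer.ι f g)
  rw [← Category.id_comp f, ← Category.id_comp g, ← hl, Category.assoc, Category.assoc,
    equalizer.condition]

/-- Over a void object every subset is a singleton, since the locus where it is one is a subobject
and hence everything. -/
lemma IsVoid.exists_hom {W : E} (h : IsVoid W) (X : E) : Nonempty (W ⟶ X) := by
  obtain ⟨l, hl⟩ := h.exists_section
    (pullback.fst (MonoidalClosed.curry (top (X ⊗ W))) (singleton X))
  exact ⟨l ≫ pullback.snd _ _⟩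

variable (E) in
/-- There is a void object: the intersection of all subobjects of `1`, internally. -/
lemma exists_isVoid : ∃ (O : E), IsVoid O := by
  obtain ⟨O, z, _, hz⟩ :=
    (IsComprehensible.isTrue (E := E) (fst (Ω E) (𝟙_ E))).forall_lift.exists_mono
  refine ⟨O, fun V f p ↦ ?_⟩
  simpa using (hz z).2 ⟨𝟙 _, by simp⟩ f p

lemma IsVoid.mono {O X : E} (h : IsVoid O) (f : O ⟶ X) : Mono f :=
  ⟨fun _ _ _ ↦ (h.of_hom ‹_›).hom_ext _ _⟩

/-- Disjointness of 1 + 1: a truth value that is true on one summand and false on the other makes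
falsity hold wherever the summands meet. -/
lemma isVoid_of_inl_eq_inr {P : E} {i j : 𝟙_ E ⟶ P} (hc : IsColimit (BinaryCofan.mk i j)) {W : E}
    (h : toUnit W ≫ i = toUnit W ≫ j) : IsVoid W := by
  obtain ⟨O, hO⟩ := exists_isVoid E
  have := hO.mono (toUnit O)
  obtain ⟨d, hd₁, hd₂⟩ : ∃ d : P ⟶ Ω E, i ≫ d = top (𝟙_ E) ∧ j ≫ d = χ (toUnit O) :=
    ⟨hc.desc (BinaryCofan.mk _ _), hc.fac _ ⟨.left⟩, hc.fac _ ⟨.right⟩⟩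
  have : IsTrue (toUnit W ≫ χ (toUnit O)) := by
    rw [← hd₂, ← Category.assoc, ← h, Category.assoc, hd₁, comp_top, isTrue_iff]
  obtain ⟨l, -⟩ := (isTrue_comp_χ_iff _ _).1 this
  exact hO.of_hom l

end Colimits

/-! ### Unions and coproduct inclusions in a dominance. -/

section Dominance

open HasSubobjectClassifier

variable {E : Type u} [Category.{v} E] [CartesianMonoidalCategory E] [HasFiniteLimits E]
  [MonoidalClosed E] [HasSubobjectClassifier E] {S : MorphismProperty E}

lemma IsDominance.of_factorizations (hS : IsDominance S) {K L X : E} {k : K ⟶ X} (hk : S k)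
    {l : L ⟶ X} [Mono l] {a : K ⟶ L} {b : L ⟶ K} (ha : a ≫ l = k) (hb : b ≫ k = l) : S l := by
  have := hS.mono _ hk
  have : Mono k := this
  have hba : b ≫ a = 𝟙 _ := by rw [← cancel_mono l]; simp [ha, hb]
  have hab : a ≫ b = 𝟙 _ := by rw [← cancel_mono k]; simp [ha, hb]
  have := hS.comp
  rw [← hb]
  exact S.comp_mem _ _ (hS.iso _ ⟨a, hba, hab⟩) hk

lemma IsDominance.of_χ_eq (hS : IsDominance S) {K L X : E} {k : K ⟶ X} [Mono k] (hk : S k)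
    {l : L ⟶ X} [Mono l] (h : χ k = χ l) : S l := by
  obtain ⟨a, ha⟩ := (isTrue_comp_χ_iff l k).1 (h ▸ (isTrue_comp_χ_iff k k).2 ⟨𝟙 _, by simp⟩)
  obtain ⟨b, hb⟩ := (isTrue_comp_χ_iff k l).1 (h ▸ (isTrue_comp_χ_iff l l).2 ⟨𝟙 _, by simp⟩)
  exact hS.of_factorizations hk ha hb

lemma IsDominance.of_isVoid (hS : IsDominance S) (hunion : IsClosedUnderFiniteUnions S)
    {O X : E} (h : IsVoid O) (f : O ⟶ X) : S f := by
  have := h.mono f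
  have hlub : IsLUB ∅ (Subobject.mk f) := by
    rw [isLUB_empty_iff]
    intro a
    obtain ⟨x⟩ := h.exists_hom (a : E)
    exact Subobject.mk_le_of_comm x (h.hom_ext _ _)
  refine hS.of_factorizations (hunion X ∅ Set.finite_empty (by simp) _ hlub)
    (a := (Subobject.underlyingIso f).hom) (b := (Subobject.underlyingIso f).inv) (by simp)
    (by simp)

lemma IsDominance.union (hS : IsDominance S) (hunion : IsClosedUnderFiniteUnions S)
    {U V Z T : E} {u : U ⟶ Z} {v : V ⟶ Z} {t : T ⟶ Z} {u' : U ⟶ T} {v' : V ⟶ T}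
    (hu : S u) (hv : S v) [Mono t] (hut : u' ≫ t = u) (hvt : v' ≫ t = v)
    (h : ∀ ⦃K : E⦄ (k : K ⟶ Z), Mono k → (∃ l, l ≫ k = u) → (∃ l, l ≫ k = v) →
      ∃ l, l ≫ k = t) : S t := by
  have : Mono u := hS.mono _ hu
  have : Mono v := hS.mono _ hv
  have hlub : IsLUB {Subobject.mk u, Subobject.mk v} (Subobject.mk t) := by
    constructor
    · rintro _ (rfl | rfl)
      · exact Subobject.mk_le_mk_of_comm u' hut
      · exact Subobject.mk_le_mk_of_comm v' hvt
    · intro a ha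
      obtain ⟨l, hl⟩ := h a.arrow inferInstance
        ⟨Subobject.ofMkLE u a (ha (by simp)), by simp⟩
        ⟨Subobject.ofMkLE v a (ha (by simp)), by simp⟩
      exact Subobject.mk_le_of_comm l hl
  have hmk : ∀ {W : E} (w : W ⟶ Z) [Mono w], S w → S (Subobject.mk w).arrow := fun w _ hw ↦
    hS.of_factorizations hw (a := (Subobject.underlyingIso w).inv)
      (b := (Subobject.underlyingIso w).hom) (by simp) (by simp)
  refine hS.of_factorizations (hunion Z _ (by simp) ?_ _ hlub)
    (a := (Subobject.underlyingIso t).hom) (b := (Subobject.underlyingIso t).inv) (by simp)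
    (by simp)
  rintro _ (rfl | rfl)
  · exact hmk u hu
  · exact hmk v hv

/-- The union of two subobjects in `S` is in `S`, and it is the pushout of the intersection. -/
lemma IsDominance.exists_isPushout (hS : IsDominance S) (hunion : IsClosedUnderFiniteUnions S)
    {I U V Z : E} {f : I ⟶ U} {g : I ⟶ V} {u : U ⟶ Z} {v : V ⟶ Z} (hu : S u) (hv : S v)
    (sq : IsPullback f g u v) :
    ∃ (T : E) (t : T ⟶ Z) (u' : U ⟶ T) (v' : V ⟶ T), S t ∧ u' ≫ t = u ∧ v' ≫ t = v ∧
      IsPushout f g u' v' := by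
  have : Mono u := hS.mono _ hu
  have : Mono v := hS.mono _ hv
  obtain ⟨T, t, u', v', _, h1, h2, h3⟩ := exists_union u v
  exact ⟨T, t, u', v', hS.union hunion hu hv h1 h2 h3, h1, h2, isPushout_of_isUnion sq h1 h2 h3⟩

/-- The whole of 1 and its void subobject are both in `S`, so both have classifying points in the
base `B` of the terminal map `m`. Their copairing pulls `m` back to a subobject of 1 + 1 that is
everything on the first summand and void on the second, that is, to `i`. With this each endpoint of
the interval is in `S`. -/
lemma IsDominance.inl (hS : IsDominance S) (hunion : IsClosedUnderFiniteUnions S) {P : E}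
    {i j : 𝟙_ E ⟶ P} (hc : IsColimit (BinaryCofan.mk i j)) : S i := by
  obtain ⟨O, hO⟩ := exists_isVoid E
  have hz := hS.of_isVoid hunion hO (toUnit O)
  obtain ⟨A, B, m, hm, hm'⟩ := hS.exists_terminal
  obtain ⟨⟨p, s⟩, hps, -⟩ := hm' _ _ (𝟙 (𝟙_ E)) (hS.iso _ inferInstance)
  obtain ⟨⟨q, r⟩, hqr, -⟩ := hm' _ _ _ hz
  dsimp at hps hqr
  obtain ⟨d, hd₁, hd₂⟩ : ∃ d : P ⟶ B, i ≫ d = s ∧ j ≫ d = r :=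
    ⟨hc.desc (BinaryCofan.mk _ _), hc.fac _ ⟨.left⟩, hc.fac _ ⟨.right⟩⟩
  have := hS.pullback
  have hk : S (pullback.fst d m) := S.pullback_fst _ _ hm
  have : Mono (pullback.fst d m) := hS.mono _ hk
  have : Mono i := mono_of_mono_fac (toUnit_unique (i ≫ toUnit P) (𝟙 _))
  refine hS.of_χ_eq hk ?_
  have h1 : i ≫ χ (pullback.fst d m) = i ≫ χ i := by
    rw [(isTrue_iff _).1 ((isTrue_comp_χ_iff i i).2 ⟨𝟙 _, by simp⟩), ← isTrue_iff,
      isTrue_comp_χ_iff]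
    exact ⟨pullback.lift i p (by rw [hd₁, hps.w, Category.id_comp]),
      pullback.lift_fst _ _ _⟩
  have h2 : j ≫ χ (pullback.fst d m) = j ≫ χ i := by
    refine truthValue_ext fun W w ↦ ?_
    rw [← Category.assoc, ← Category.assoc, isTrue_comp_χ_iff, isTrue_comp_χ_iff]
    suffices h : (∃ l, l ≫ pullback.fst d m = w ≫ j) ∨ (∃ l, l ≫ i = w ≫ j) → IsVoid W by
      constructor
      · intro hl
        exact (isTrue_comp_χ_iff _ _).1 (h (.inl hl) (𝟙 _) _)
      · intro hl
        exact (isTrue_comp_χ_iff _ _).1 (h (.inr hl) (𝟙 _) _)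
    rintro (⟨l, hl⟩ | ⟨l, hl⟩)
    · have : (l ≫ pullback.snd d m) ≫ m = w ≫ r := by
        rw [Category.assoc, ← pullback.condition, ← Category.assoc, hl, Category.assoc, hd₂]
      exact hO.of_hom (hqr.lift _ _ this)
    · rw [toUnit_unique l (toUnit W), toUnit_unique w (toUnit W)] at hl
      exact isVoid_of_inl_eq_inr hc hl
  exact BinaryCofan.IsColimit.hom_ext hc h1 h2

end Dominance

/-! ### Classification of partial maps, and the factorisation through `S`. -/

section PartialMaps

open HasSubobjectClassifier

variable {E : Type u} [Category.{v} E] [CartesianMonoidalCategory E] [HasFiniteLimits E]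
  [MonoidalClosed E] [HasSubobjectClassifier E] {S : MorphismProperty E}

/-- The predicate on `X ⊗ N` given by the graph of a partial map `h : M ⟶ X` defined on the
subobject `j : M ⟶ N`. -/
noncomputable def graph {M N X : E} (j : M ⟶ N) [Mono j] (h : M ⟶ X) : X ⊗ N ⟶ Ω E :=
  have : Mono (lift h j) := mono_of_mono_fac (lift_snd h j)
  χ (lift h j)

lemma isTrue_lift_graph_iff {M N X V : E} (j : M ⟶ N) [Mono j] (h : M ⟶ X) (x : V ⟶ X)
    (n : V ⟶ N) : IsTrue (lift x n ≫ graph j h) ↔ ∃ r, r ≫ h = x ∧ r ≫ j = n := by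
  have : Mono (lift h j) := mono_of_mono_fac (lift_snd h j)
  rw [graph, isTrue_comp_χ_iff]
  refine exists_congr fun r ↦ ⟨fun hr ↦ ⟨?_, ?_⟩, fun ⟨h1, h2⟩ ↦ by simp [h1, h2]⟩
  · simpa using congr($hr ≫ fst _ _)
  · simpa using congr($hr ≫ snd _ _)

lemma comp_curry_graph {M N X : E} (j : M ⟶ N) [Mono j] (h : M ⟶ X) :
    j ≫ MonoidalClosed.curry (graph j h) = h ≫ singleton X := by
  rw [singleton, comp_curry_eq_iff]
  intro V x y
  rw [isTrue_lift_graph_iff, isTrue_lift_equality_iff]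
  constructor
  · rintro ⟨r, rfl, hr⟩
    rw [(cancel_mono j).1 hr]
  · rintro rfl
    exact ⟨y, rfl, rfl⟩

/-- Every map factors as a map in the dominance `S` followed by a map with the right lifting
property against `S`: the object in the middle classifies the partial maps over the target whose
domain of definition is in `S`. -/
lemma IsDominance.exists_factorization (hS : IsDominance S) {X Y : E} (f : X ⟶ Y) :
    ∃ (Z : E) (k : X ⟶ Z) (q : Z ⟶ Y), S k ∧ S.rlp q ∧ k ≫ q = f := by
  have := hS.pullback
  have := hS.comp
  obtain ⟨A, B, m, hm, hm'⟩ := hS.exists_terminal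
  have : Mono m := hS.mono _ hm
  -- `A` is subterminal: each map from W to `A` yields a pullback square from the identity of W to
  -- `m`, and such a square is unique.
  have hA : ∀ ⦃W : E⦄ (a a' : W ⟶ A), a = a' := by
    intro W a a'
    have key : ∀ a : W ⟶ A, IsPullback a (𝟙 W) m (a ≫ m) := fun a ↦
      IsPullback.of_isLimit' ⟨by simp⟩ (PullbackCone.IsLimit.mk _ (fun s ↦ s.snd)
        (fun s ↦ by rw [← cancel_mono m, s.condition, Category.assoc]) (fun s ↦ by simp)
        (fun s l _ h2 ↦ by simpa using h2))
    obtain ⟨p, -, hp⟩ := hm' _ _ (𝟙 W) (hS.iso _ inferInstance)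
    exact congr_arg Prod.fst ((hp (a, a ≫ m) (key a)).trans (hp (a', a' ≫ m) (key a')).symm)
  obtain ⟨⟨a, s⟩, has, -⟩ := hm' _ _ (𝟙 X) (hS.iso _ inferInstance)
  dsimp at has
  have has' : s = a ≫ m := by rw [has.w, Category.id_comp]
  clear has
  -- An element of the ambient object is a point of `Y`, a truth value of the dominance and a subset
  -- of `X`; `e` sends x to (f(x), true, {x}).
  let σ : Y ⊗ (B ⊗ (ihom X).obj (Ω E)) ⟶ B := snd _ _ ≫ fst _ _
  let π : Y ⊗ (B ⊗ (ihom X).obj (Ω E)) ⟶ (ihom X).obj (Ω E) := snd _ _ ≫ snd _ _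
  let e : X ⟶ Y ⊗ (B ⊗ (ihom X).obj (Ω E)) := lift f (lift (a ≫ m) (singleton X))
  have he₁ : e ≫ fst _ _ = f := by simp [e]
  have he₂ : e ≫ σ = a ≫ m := by simp [e, σ]
  have he₃ : e ≫ π = singleton X := by simp [e, π]
  have : Mono e := mono_of_mono_fac he₃
  have hom_ext : ∀ ⦃W : E⦄ (w w' : W ⟶ Y ⊗ (B ⊗ (ihom X).obj (Ω E))),
      w ≫ fst _ _ = w' ≫ fst _ _ → w ≫ σ = w' ≫ σ → w ≫ π = w' ≫ π → w = w' := by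
    intro W w w' h1 h2 h3
    ext
    · exact h1
    · simpa using h2
    · simpa using h3
  -- `Z` consists of the triples that are in the image of `e` exactly when their truth value is
  -- true, and whose subset can have elements only when it is true.
  obtain ⟨Z, κ, _, hκ⟩ := ((IsComprehensible.eq (σ ≫ χ m) (χ e)).and
    ((IsComprehensible.isTrue (X ◁ π ≫ (ihom.ev X).app (Ω E))).imp
      (IsComprehensible.isTrue (snd _ _ ≫ σ ≫ χ m))).forall_lift).exists_mono
  have hκ₁ : ∀ ⦃W : E⦄ (w : W ⟶ Z), IsTrue (w ≫ κ ≫ σ ≫ χ m) ↔ ∃ l, l ≫ e = w ≫ κ := by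
    intro W w
    have := ((hκ κ).2 ⟨𝟙 _, by simp⟩).1
    rw [this, ← Category.assoc, isTrue_comp_χ_iff]
  have hκ₂ : ∀ ⦃W : E⦄ (w : W ⟶ Z) (x : W ⟶ X),
      IsTrue (lift x (w ≫ κ ≫ π) ≫ (ihom.ev X).app (Ω E)) → IsTrue (w ≫ κ ≫ σ ≫ χ m) := by
    intro W w x h
    have := ((hκ κ).2 ⟨𝟙 _, by simp⟩).2 w x (𝟙 _)
    simp only [Category.id_comp, lift_whiskerLeft_assoc, lift_snd_assoc, Category.assoc] at this
    exact this h
  obtain ⟨k, hk⟩ : ∃ k, k ≫ κ = e := by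
    have htrue : e ≫ σ ≫ χ m = top X := by
      rw [← isTrue_iff, ← Category.assoc, isTrue_comp_χ_iff]
      exact ⟨a, he₂.symm⟩
    refine (hκ e).1 ⟨?_, fun V f x V' g _ ↦ ?_⟩
    · rw [htrue, eq_comm, ← isTrue_iff, isTrue_comp_χ_iff]
      exact ⟨𝟙 _, by simp⟩
    · simp only [lift_snd_assoc, Category.assoc, htrue, comp_top, isTrue_iff]
  have hkpb : IsPullback a k m (κ ≫ σ) := by
    have h : ∀ (s : PullbackCone m (κ ≫ σ)), ∃ l, l ≫ e = s.snd ≫ κ := by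
      intro s
      have h := (isTrue_comp_χ_iff m (s.snd ≫ κ ≫ σ)).2 ⟨s.fst, s.condition⟩
      rw [Category.assoc, Category.assoc] at h
      exact (hκ₁ _).1 h
    refine IsPullback.of_isLimit' ⟨?_⟩ (PullbackCone.IsLimit.mk _ (fun s ↦ (h s).choose)
        (fun s ↦ hA _ _) (fun s ↦ ?_) (fun s l _ h2 ↦ ?_))
    · rw [← Category.assoc, hk, ← he₂]
    · rw [← cancel_mono κ, Category.assoc, hk, (h s).choose_spec]
    · rw [← cancel_mono e, (h s).choose_spec, ← hk, ← h2, Category.assoc]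
  have hSk : S k := S.of_isPullback hkpb hm
  refine ⟨Z, k, κ ≫ fst _ _, hSk, ?_, by rw [← Category.assoc, hk, he₁]⟩
  intro M N u hu
  refine ⟨fun {g b} sq ↦ ?_⟩
  have hgb : g ≫ κ ≫ fst _ _ = u ≫ b := sq.w
  have hi := S.pullback_fst g k hSk
  have hcond := pullback.condition (f := g) (g := k)
  have hpb := IsPullback.of_hasPullback g k
  set M' := Limits.pullback g k
  set i : M' ⟶ M := Limits.pullback.fst g k
  set h : M' ⟶ X := pullback.snd g k
  have hiu : S (i ≫ u) := S.comp_mem _ _ hi hu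
  have : Mono u := hS.mono _ hu
  have : Mono i := hS.mono _ hi
  obtain ⟨⟨p, t⟩, hpt, -⟩ := hm' _ _ (i ≫ u) hiu
  dsimp at hpt
  -- The part of M mapped by `g` into `X` is a partial map from N to X with domain in `S`; `c`
  -- records it by the truth value of its domain and the fibres of its graph.
  let c : N ⟶ Y ⊗ (B ⊗ (ihom X).obj (Ω E)) :=
    lift b (lift t (MonoidalClosed.curry (graph (i ≫ u) h)))
  have hc₁ : c ≫ fst _ _ = b := by simp [c]
  have hc₂ : c ≫ σ = t := by simp [c, σ]
  have hc₃ : c ≫ π = MonoidalClosed.curry (graph (i ≫ u) h) := by simp [c, π]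
  have hc_restrict : (i ≫ u) ≫ c = h ≫ e := by
    refine hom_ext _ _ ?_ ?_ ?_
    · rw [Category.assoc, hc₁, Category.assoc h, he₁, Category.assoc i, ← hgb,
        reassoc_of% hcond, reassoc_of% hk, he₁]
    · rw [Category.assoc, hc₂, Category.assoc h, he₂, ← hpt.w, hA p (h ≫ a), Category.assoc]
    · rw [Category.assoc, hc₃, Category.assoc h, he₃, comp_curry_graph]
  obtain ⟨d, hd⟩ : ∃ d, d ≫ κ = c := by
    refine (hκ c).1 ⟨truthValue_ext fun W w ↦ ?_, fun V n x V' y hy ↦ ?_⟩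
    · rw [← Category.assoc c, hc₂, ← Category.assoc, isTrue_comp_χ_iff, ← Category.assoc w c,
        isTrue_comp_χ_iff]
      constructor
      · rintro ⟨l, hl⟩
        obtain ⟨r, -, hr⟩ := hpt.exists_lift l w hl
        exact ⟨r ≫ h, by rw [Category.assoc, ← hc_restrict, ← Category.assoc, hr]⟩
      · rintro ⟨l, hl⟩
        refine ⟨l ≫ a, ?_⟩
        rw [Category.assoc, ← he₂, ← Category.assoc, hl, Category.assoc, hc₂]
    · have hy' : lift (y ≫ x) (((y ≫ n) ≫ c) ≫ π) =
          y ≫ lift x (n ≫ c) ≫ X ◁ π := by simp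
      replace hy : IsTrue (lift (y ≫ x) (((y ≫ n) ≫ c) ≫ π) ≫ (ihom.ev X).app (Ω E)) := by
        rw [hy']
        simpa only [Category.assoc] using hy
      rw [Category.assoc _ c, hc₃, lift_comp_curry_ev, isTrue_lift_graph_iff] at hy
      obtain ⟨r, hr₁, hr₂⟩ := hy
      rw [Category.assoc y, lift_snd_assoc, Category.assoc, ← Category.assoc c, hc₂, ← Category.assoc n,
        ← Category.assoc, ← Category.assoc, ← hr₂, isTrue_comp_χ_iff]
      exact ⟨r ≫ p, by rw [Category.assoc, Category.assoc, hpt.w]⟩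
  refine ⟨⟨⟨d, ?_, by rw [← Category.assoc, hd, hc₁]⟩⟩⟩
  rw [← cancel_mono κ, Category.assoc, hd]
  refine hom_ext _ _ ?_ ?_ ?_
  · rw [Category.assoc, hc₁, Category.assoc, hgb]
  -- Both truth values on M classify the subobject `i`, so uniqueness of classifying squares
  -- identifies them.
  · obtain ⟨r, -, hr⟩ := hm' _ _ i hi
    have e1 : (p, u ≫ t) = r := hr _ (by
      refine IsPullback.of_isLimit' ⟨by rw [hpt.w, Category.assoc]⟩
        (PullbackCone.IsLimit.mk _
        (fun s ↦ hpt.lift s.fst (s.snd ≫ u) (by rw [s.condition, Category.assoc]))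
        (fun s ↦ hA _ _) (fun s ↦ ?_) (fun s l _ h2 ↦ ?_))
      · rw [← cancel_mono u, Category.assoc]
        exact hpt.lift_snd _ _ _
      · rw [← cancel_mono (i ≫ u)]
        refine Eq.trans ?_ (hpt.lift_snd _ _ _).symm
        rw [← h2, Category.assoc])
    have e2 : (h ≫ a, g ≫ κ ≫ σ) = r := hr _ (hpb.flip.paste_horiz hkpb)
    rw [Category.assoc, hc₂, Category.assoc]
    exact congr_arg Prod.snd (e1.trans e2.symm)
  · apply MonoidalClosed.uncurry_injective
    refine truthValue_ext fun V v ↦ ?_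
    have key : ∀ z : M ⟶ (ihom X).obj (Ω E), v ≫ MonoidalClosed.uncurry z =
        lift (v ≫ fst _ _) ((v ≫ snd _ _) ≫ z) ≫ (ihom.ev X).app (Ω E) := by
      intro z
      rw [MonoidalClosed.uncurry_eq, ← Category.assoc]
      congr 1
      ext <;> simp
    rw [key, key]
    generalize v ≫ fst _ _ = x
    generalize v ≫ snd _ _ = y
    rw [Category.assoc u, hc₃, ← Category.assoc y, lift_comp_curry_ev, isTrue_lift_graph_iff]
    -- Over M' both subsets are the singleton of the value of `h`. Elsewhere nothing needs
    -- comparing: an element of either subset forces the point into M'.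
    have h3 : ∀ r : V ⟶ M', r ≫ i = y →
        (IsTrue (lift x (y ≫ (g ≫ κ) ≫ π) ≫ (ihom.ev X).app (Ω E)) ↔ x = r ≫ h) := by
      rintro r rfl
      rw [← isTrue_lift_equality_iff, ← lift_comp_curry_ev x (r ≫ h) (equality X)]
      have : (r ≫ i) ≫ (g ≫ κ) ≫ π = (r ≫ h) ≫ MonoidalClosed.curry (equality X) := by
        rw [← singleton, ← he₃, ← hk]
        simp only [Category.assoc]
        rw [reassoc_of% hcond]
      rw [this]
    constructor
    · rintro ⟨r, hr₁, hr₂⟩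
      rw [h3 r ((cancel_mono u).1 (by simpa using hr₂)), hr₁]
    · intro hT
      have h4 := hκ₂ (y ≫ g) x (by simpa using hT)
      obtain ⟨l, hl⟩ := (hκ₁ _).1 h4
      obtain ⟨r, hr, -⟩ := hpb.exists_lift y l (by
        rw [← cancel_mono κ, Category.assoc l, hk, hl])
      exact ⟨r, ((h3 r hr).1 hT).symm, by rw [← Category.assoc, hr]⟩

end PartialMaps

/-! ### Leibniz products with an endpoint, as lifting problems without pushouts. -/

section Boxes

variable {E : Type u} [Category.{v} E] [CartesianMonoidalCategory E] {I : E}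

/-- The inclusion of `B` in `I ⊗ B` at a point of `I`. -/
def atPoint (d : 𝟙_ E ⟶ I) (B : E) : B ⟶ I ⊗ B := lift (toUnit B ≫ d) (𝟙 B)

lemma atPoint_naturality (d : 𝟙_ E ⟶ I) {X Y : E} (f : X ⟶ Y) :
    atPoint d X ≫ I ◁ f = f ≫ atPoint d Y := by
  simp only [atPoint, lift_whiskerLeft, Category.id_comp, comp_lift, Category.comp_id]
  rw [← Category.assoc, comp_toUnit]

lemma atPoint_naturality_assoc (d : 𝟙_ E ⟶ I) {X Y Z : E} (f : X ⟶ Y) (g : I ⊗ Y ⟶ Z) :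
    atPoint d X ≫ I ◁ f ≫ g = f ≫ atPoint d Y ≫ g := by
  rw [← Category.assoc, atPoint_naturality, Category.assoc]

@[simp]
lemma atPoint_snd (d : 𝟙_ E ⟶ I) (X : E) : atPoint d X ≫ snd I X = 𝟙 X := by simp [atPoint]

@[simp]
lemma atPoint_snd_assoc (d : 𝟙_ E ⟶ I) (X : E) {Z : E} (g : X ⟶ Z) :
    atPoint d X ≫ snd I X ≫ g = g := by
  rw [← Category.assoc, atPoint_snd, Category.id_comp]

@[simp]
lemma atPoint_fst (d : 𝟙_ E ⟶ I) (X : E) : atPoint d X ≫ fst I X = toUnit X ≫ d := by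
  simp [atPoint]

lemma whiskerRight_eq (d : 𝟙_ E ⟶ I) (X : E) : d ▷ X = (λ_ X).hom ≫ atPoint d X := by
  ext
  · simp [leftUnitor_hom, toUnit_unique (fst (𝟙_ E) X) (snd (𝟙_ E) X ≫ toUnit X)]
  · simp [leftUnitor_hom]

lemma isPullback_atPoint_whiskerLeft (d : 𝟙_ E ⟶ I) {X Y : E} (u : X ⟶ Y) :
    IsPullback (atPoint d X) u (I ◁ u) (atPoint d Y) := by
  refine IsPullback.of_isLimit' ⟨atPoint_naturality d u⟩ (PullbackCone.IsLimit.mk _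
    (fun s ↦ s.fst ≫ snd _ _) (fun s ↦ ?_) (fun s ↦ ?_) (fun s l h1 _ ↦ ?_))
  · have h := congr($(s.condition) ≫ fst _ _)
    simp only [Category.assoc, whiskerLeft_fst, atPoint_fst] at h
    ext
    · simp only [Category.assoc, atPoint_fst, h]
      simp only [← Category.assoc, comp_toUnit]
    · simp
  · simpa using congr($(s.condition) ≫ snd _ _)
  · simp [← h1]

lemma isPullback_atPoint (d : 𝟙_ E ⟶ I) (Y : E) :
    IsPullback (toUnit Y) (atPoint d Y) d (fst I Y) := by
  refine IsPullback.of_isLimit' ⟨(atPoint_fst d Y).symm⟩ (PullbackCone.IsLimit.mk _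
    (fun s ↦ s.snd ≫ snd _ _) (fun s ↦ toUnit_unique _ _) (fun s ↦ ?_) (fun s l _ h2 ↦ ?_))
  · ext
    · simp only [Category.assoc, atPoint_fst, ← s.condition]
      rw [← Category.assoc, ← Category.assoc]
      congr 1
      exact toUnit_unique _ _
    · simp
  · simp [← h2]

lemma isPullback_whiskerLeft (I : E) {X Y : E} (u : X ⟶ Y) :
    IsPullback (snd I X) (I ◁ u) u (snd I Y) := by
  refine IsPullback.of_isLimit' ⟨by simp⟩ (PullbackCone.IsLimit.mk _
    (fun s ↦ lift (s.snd ≫ fst _ _) s.fst) (fun s ↦ by simp) (fun s ↦ ?_) (fun s l h1 h2 ↦ ?_))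
  · ext
    · simp
    · simpa using s.condition
  · ext
    · simp [← h2]
    · simp [← h1]

lemma isPullback_whiskerRight {I J : E} (u : I ⟶ J) (X : E) :
    IsPullback (fst I X) (u ▷ X) u (fst J X) := by
  refine IsPullback.of_isLimit' ⟨by simp⟩ (PullbackCone.IsLimit.mk _
    (fun s ↦ lift s.fst (s.snd ≫ snd _ _)) (fun s ↦ by simp) (fun s ↦ ?_) (fun s l h1 h2 ↦ ?_))
  · ext
    · simpa using s.condition
    · simp
  · ext
    · simp [← h1]
    · simp [← h2]

lemma isPullback_whiskerLeft_whiskerRight {P I X Y : E} (i : P ⟶ I) (u : X ⟶ Y) :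
    IsPullback (P ◁ u) (i ▷ X) (i ▷ Y) (I ◁ u) := by
  refine IsPullback.of_isLimit' ⟨whisker_exchange _ _⟩ (PullbackCone.IsLimit.mk _
    (fun s ↦ lift (s.fst ≫ fst _ _) (s.snd ≫ snd _ _)) (fun s ↦ ?_) (fun s ↦ ?_)
    (fun s l h1 h2 ↦ ?_))
  · ext
    · simp
    · simpa using congr($(s.condition) ≫ snd _ _).symm
  · ext
    · simpa using congr($(s.condition) ≫ fst _ _)
    · simp
  · ext
    · simp [← h1]
    · simp [← h2]

/-- The right lifting property against the Leibniz products of `d` with maps in `S`, formulated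
without the pushouts. -/
def BoxLift (d : 𝟙_ E ⟶ I) (S : MorphismProperty E) {Z W : E} (p : Z ⟶ W) : Prop :=
  ∀ ⦃X Y : E⦄ (u : X ⟶ Y), S u → ∀ (a : I ⊗ X ⟶ Z) (b : Y ⟶ Z) (c : I ⊗ Y ⟶ W),
    atPoint d X ≫ a = u ≫ b → a ≫ p = I ◁ u ≫ c → b ≫ p = atPoint d Y ≫ c →
    ∃ l : I ⊗ Y ⟶ Z, I ◁ u ≫ l = a ∧ atPoint d Y ≫ l = b ∧ l ≫ p = c

variable {d : 𝟙_ E ⟶ I} {S : MorphismProperty E}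

lemma BoxLift.hasLiftingProperty {Z W : E} {p : Z ⟶ W} (h : BoxLift d S p) {X Y : E} {u : X ⟶ Y}
    (hu : S u) (sq : (curriedTensor E).PushoutObjObj d u) : HasLiftingProperty sq.ι p := by
  have h1 : sq.inl ≫ sq.ι = I ◁ u := sq.inl_ι
  have h2 : sq.inr ≫ sq.ι = d ▷ Y := sq.inr_ι
  have h3 : d ▷ X ≫ sq.inl = 𝟙_ E ◁ u ≫ sq.inr := sq.isPushout.w
  refine ⟨fun {f g} sq' ↦ ?_⟩
  have e1 : atPoint d X ≫ sq.inl ≫ f = u ≫ (λ_ Y).inv ≫ sq.inr ≫ f := by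
    rw [← cancel_epi (λ_ X).hom, ← Category.assoc, ← whiskerRight_eq, ← Category.assoc]
    erw [h3]
    rw [← leftUnitor_naturality_assoc, Iso.hom_inv_id_assoc, Category.assoc]
  have e2 : (sq.inl ≫ f) ≫ p = I ◁ u ≫ g := by
    rw [Category.assoc, sq'.w, ← h1, Category.assoc]
  have e3 : ((λ_ Y).inv ≫ sq.inr ≫ f) ≫ p = atPoint d Y ≫ g := by
    rw [Category.assoc, Category.assoc, sq'.w, ← cancel_epi (λ_ Y).hom, Iso.hom_inv_id_assoc,
      ← Category.assoc (λ_ Y).hom, ← whiskerRight_eq, ← h2, Category.assoc]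
  obtain ⟨l, hl₁, hl₂, hl₃⟩ := h u hu (sq.inl ≫ f) ((λ_ Y).inv ≫ sq.inr ≫ f) g e1 e2 e3
  refine ⟨⟨⟨l, sq.hom_ext ?_ ?_, hl₃⟩⟩⟩
  · rw [← Category.assoc]
    erw [h1, hl₁]
  · rw [← Category.assoc]
    erw [h2]
    rw [whiskerRight_eq, Category.assoc, hl₂, Iso.hom_inv_id_assoc]

variable [HasFiniteLimits E] [MonoidalClosed E] [HasSubobjectClassifier E]

lemma IsDominance.atPoint (hS : IsDominance S) (hd : S d) (Y : E) :
    S (IntervalModel.atPoint d Y) :=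
  have := hS.pullback
  S.of_isPullback (isPullback_atPoint d Y) hd

lemma IsDominance.whiskerLeft (hS : IsDominance S) (I : E) {X Y : E} {u : X ⟶ Y} (hu : S u) :
    S (I ◁ u) :=
  have := hS.pullback
  S.of_isPullback (isPullback_whiskerLeft I u) hu

lemma IsDominance.whiskerRight (hS : IsDominance S) {X Y : E} {u : X ⟶ Y} (hu : S u) (I : E) :
    S (u ▷ I) :=
  have := hS.pullback
  S.of_isPullback (isPullback_whiskerRight u I) hu

/-- The Leibniz product of `d` and `u` is the union of I × X and {d} × Y inside I × Y. That union is
effective, so it supplies the pushout datum to which the hypothesis applies. -/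
lemma boxLift_of_hasLiftingProperty (hS : IsDominance S) (hunion : IsClosedUnderFiniteUnions S)
    (hd : S d) {Z W : E} {p : Z ⟶ W}
    (h : ∀ ⦃X Y : E⦄ (u : X ⟶ Y), S u → ∀ sq : (curriedTensor E).PushoutObjObj d u,
      HasLiftingProperty sq.ι p) : BoxLift d S p := by
  intro X Y u hu a b c hab hac hbc
  obtain ⟨T, t, u', v', -, h1, h2, h3⟩ := hS.exists_isPushout hunion (hS.whiskerLeft I hu)
    (hS.atPoint hd Y) (isPullback_atPoint_whiskerLeft d u)
  have h4 : IsPushout (d ▷ X) (𝟙_ E ◁ u) u' ((λ_ Y).hom ≫ v') :=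
    h3.of_iso (λ_ X).symm (Iso.refl _) (λ_ Y).symm (Iso.refl _)
      (by simp [whiskerRight_eq]) (by simp) (by simp) (by simp)
  let sq : (curriedTensor E).PushoutObjObj d u :=
    { pt := T
      inl := u'
      inr := (λ_ Y).hom ≫ v'
      isPushout := h4
      ι := t
      inl_ι := h1
      inr_ι := by
        rw [Category.assoc, h2]
        exact (whiskerRight_eq d Y).symm }
  have : HasLiftingProperty t p := h u hu sq
  obtain ⟨x, hx₁, hx₂⟩ := h3.exists_desc a b hab
  have hsq : CommSq x t p c := ⟨h3.hom_ext
    (by rw [← Category.assoc, ← Category.assoc, hx₁, h1, hac])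
    (by rw [← Category.assoc, ← Category.assoc, hx₂, h2, hbc])⟩
  refine ⟨hsq.lift, ?_, ?_, hsq.fac_right⟩
  · rw [← h1, Category.assoc, hsq.fac_left, hx₁]
  · rw [← h2, Category.assoc, hsq.fac_left, hx₂]

/-- The union of I × X and {d} × Y in I × Y is itself in `S`, so the lift exists directly. -/
lemma boxLift_of_rlp (hS : IsDominance S) (hunion : IsClosedUnderFiniteUnions S)
    (hd : S d) {Z W : E} {p : Z ⟶ W} (hp : S.rlp p) : BoxLift d S p := by
  intro X Y u hu a b c hab hac hbc
  obtain ⟨T, t, u', v', ht, h1, h2, h3⟩ := hS.exists_isPushout hunion (hS.whiskerLeft I hu)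
    (hS.atPoint hd Y) (isPullback_atPoint_whiskerLeft d u)
  have : HasLiftingProperty t p := hp t ht
  obtain ⟨x, hx₁, hx₂⟩ := h3.exists_desc a b hab
  have hsq : CommSq x t p c := ⟨h3.hom_ext
    (by rw [← Category.assoc, ← Category.assoc, hx₁, h1, hac])
    (by rw [← Category.assoc, ← Category.assoc, hx₂, h2, hbc])⟩
  refine ⟨hsq.lift, ?_, ?_, hsq.fac_right⟩
  · rw [← h1, Category.assoc, hsq.fac_left, hx₁]
  · rw [← h2, Category.assoc, hsq.fac_left, hx₂]

/-! ### The boundary of a cylinder, relative to a cofibration. -/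

section Boundary

variable {P : E} {i j : 𝟙_ E ⟶ P}

lemma tensor_coproduct_hom_ext (hc : IsColimit (BinaryCofan.mk i j)) {Q Z : E} {f g : Q ⊗ P ⟶ Z}
    (h1 : Q ◁ i ≫ f = Q ◁ i ≫ g) (h2 : Q ◁ j ≫ f = Q ◁ j ≫ g) : f = g := by
  apply MonoidalClosed.curry_injective
  refine BinaryCofan.IsColimit.hom_ext hc ?_ ?_
  · change i ≫ _ = i ≫ _
    rw [← MonoidalClosed.curry_natural_left, h1, MonoidalClosed.curry_natural_left]
  · change j ≫ _ = j ≫ _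
    rw [← MonoidalClosed.curry_natural_left, h2, MonoidalClosed.curry_natural_left]

lemma exists_tensor_coproduct_desc (hc : IsColimit (BinaryCofan.mk i j)) {Q Z : E}
    (a b : Q ⊗ 𝟙_ E ⟶ Z) : ∃ f : Q ⊗ P ⟶ Z, Q ◁ i ≫ f = a ∧ Q ◁ j ≫ f = b := by
  obtain ⟨c, hc₁, hc₂⟩ : ∃ c : P ⟶ (ihom Q).obj Z, i ≫ c = MonoidalClosed.curry a ∧
      j ≫ c = MonoidalClosed.curry b :=
    ⟨hc.desc (BinaryCofan.mk _ _), hc.fac _ ⟨.left⟩, hc.fac _ ⟨.right⟩⟩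
  refine ⟨MonoidalClosed.uncurry c, ?_, ?_⟩
  · rw [← MonoidalClosed.uncurry_natural_left, hc₁, MonoidalClosed.uncurry_curry]
  · rw [← MonoidalClosed.uncurry_natural_left, hc₂, MonoidalClosed.uncurry_curry]

/-- The permutation `(K ⊗ Y) ⊗ P ≅ K ⊗ (P ⊗ Y)`. -/
@[simps]
def permute (K Y P : E) : (K ⊗ Y) ⊗ P ≅ K ⊗ (P ⊗ Y) where
  hom := lift (fst _ _ ≫ fst _ _) (lift (snd _ _) (fst _ _ ≫ snd _ _))
  inv := lift (lift (fst _ _) (snd _ _ ≫ snd _ _)) (snd _ _ ≫ fst _ _)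

lemma whiskerLeft_atPoint_eq (K Y : E) (i : 𝟙_ E ⟶ P) :
    K ◁ atPoint i Y = (ρ_ _).inv ≫ (K ⊗ Y) ◁ i ≫ (permute K Y P).hom := by
  ext
  · simp
  · simp only [atPoint_fst, Category.assoc, permute_hom, lift_snd_assoc,
      lift_fst, whiskerLeft_snd, rightUnitor_inv_snd_assoc]
    simp only [← Category.assoc, comp_toUnit]
  · simp

lemma whiskerLeft_tensor_coproduct_hom_ext (hc : IsColimit (BinaryCofan.mk i j)) {K Y Z : E}
    {f g : K ⊗ (P ⊗ Y) ⟶ Z}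
    (h1 : K ◁ atPoint i Y ≫ f = K ◁ atPoint i Y ≫ g)
    (h2 : K ◁ atPoint j Y ≫ f = K ◁ atPoint j Y ≫ g) : f = g := by
  rw [← cancel_epi (permute K Y P).hom]
  rw [whiskerLeft_atPoint_eq, Category.assoc, Category.assoc, Category.assoc, Category.assoc,
    cancel_epi] at h1 h2
  exact tensor_coproduct_hom_ext hc h1 h2

lemma exists_whiskerLeft_tensor_coproduct_desc (hc : IsColimit (BinaryCofan.mk i j)) {K Y Z : E}
    (a b : K ⊗ Y ⟶ Z) :
    ∃ f : K ⊗ (P ⊗ Y) ⟶ Z, K ◁ atPoint i Y ≫ f = a ∧ K ◁ atPoint j Y ≫ f = b := by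
  obtain ⟨f, h1, h2⟩ := exists_tensor_coproduct_desc hc ((ρ_ _).hom ≫ a) ((ρ_ _).hom ≫ b)
  refine ⟨(permute K Y P).inv ≫ f, ?_, ?_⟩
  · rw [whiskerLeft_atPoint_eq]
    simp only [Category.assoc, Iso.hom_inv_id_assoc, h1, Iso.inv_hom_id_assoc]
  · rw [whiskerLeft_atPoint_eq]
    simp only [Category.assoc, Iso.hom_inv_id_assoc, h2, Iso.inv_hom_id_assoc]

lemma atPoint_comp_whiskerRight (i : 𝟙_ E ⟶ P) (k : P ⟶ I) (Y : E) :
    atPoint i Y ≫ k ▷ Y = atPoint (i ≫ k) Y := by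
  simp [atPoint]

/-- Maps that become equal after composition with a map that lifts against `S` are homotopic. -/
lemma exists_homotopy_of_rlp (hS : IsDominance S) (hc : IsColimit (BinaryCofan.mk i j))
    {k : P ⟶ I} (hk : S k) {X Z W : E} {p : Z ⟶ W} (hp : S.rlp p) {f g : X ⟶ Z}
    (hfg : f ≫ p = g ≫ p) :
    ∃ H : I ⊗ X ⟶ Z, atPoint (i ≫ k) X ≫ H = f ∧ atPoint (j ≫ k) X ≫ H = g := by
  have unit : ∀ {U V : E} (c : U ⟶ V), c = (λ_ U).inv ≫ 𝟙_ E ◁ c ≫ (λ_ V).hom := by simp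
  obtain ⟨c, hc₀, hc₁⟩ : ∃ c : P ⊗ X ⟶ Z, atPoint i X ≫ c = f ∧ atPoint j X ≫ c = g := by
    obtain ⟨c, h₀, h₁⟩ := exists_whiskerLeft_tensor_coproduct_desc hc
      ((λ_ X).hom ≫ f) ((λ_ X).hom ≫ g)
    refine ⟨(λ_ _).inv ≫ c, ?_, ?_⟩
    · rw [unit (atPoint i X)]
      simp only [Category.assoc, Iso.hom_inv_id_assoc, h₀, Iso.inv_hom_id_assoc]
    · rw [unit (atPoint j X)]
      simp only [Category.assoc, Iso.hom_inv_id_assoc, h₁, Iso.inv_hom_id_assoc]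
  have sq : CommSq c (k ▷ X) p (snd _ _ ≫ f ≫ p) := by
    refine ⟨?_⟩
    rw [← cancel_epi (λ_ _).hom]
    refine whiskerLeft_tensor_coproduct_hom_ext hc ?_ ?_
    · rw [leftUnitor_naturality_assoc, leftUnitor_naturality_assoc, reassoc_of% hc₀,
        whiskerRight_snd_assoc, atPoint_snd_assoc]
    · rw [leftUnitor_naturality_assoc, leftUnitor_naturality_assoc, reassoc_of% hc₁,
        whiskerRight_snd_assoc, atPoint_snd_assoc, hfg]
  have := hp _ (hS.whiskerRight hk X)
  refine ⟨sq.lift, ?_, ?_⟩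
  · rw [← atPoint_comp_whiskerRight, Category.assoc, sq.fac_left, hc₀]
  · rw [← atPoint_comp_whiskerRight, Category.assoc, sq.fac_left, hc₁]

/-- The union of `1 + 1` times `Y` with `I` times `X`, as a subobject of `I ⊗ Y`, together with
its universal property, which is stable under products with `I`. -/
lemma exists_boundary (hS : IsDominance S) (hunion : IsClosedUnderFiniteUnions S)
    (hc : IsColimit (BinaryCofan.mk i j)) {k : P ⟶ I} (hk : S k) {X Y : E} {u : X ⟶ Y}
    (hu : S u) :
    ∃ (W : E) (w : W ⟶ I ⊗ Y) (w₀ w₁ : Y ⟶ W) (wI : I ⊗ X ⟶ W), S w ∧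
      w₀ ≫ w = atPoint (i ≫ k) Y ∧ w₁ ≫ w = atPoint (j ≫ k) Y ∧ wI ≫ w = I ◁ u ∧
      (∀ ⦃Z : E⦄ (f g : I ⊗ W ⟶ Z), I ◁ w₀ ≫ f = I ◁ w₀ ≫ g → I ◁ w₁ ≫ f = I ◁ w₁ ≫ g →
        I ◁ wI ≫ f = I ◁ wI ≫ g → f = g) ∧
      ∀ ⦃Z : E⦄ (a₀ a₁ : I ⊗ Y ⟶ Z) (aI : I ⊗ (I ⊗ X) ⟶ Z),
        I ◁ atPoint (i ≫ k) X ≫ aI = I ◁ u ≫ a₀ → I ◁ atPoint (j ≫ k) X ≫ aI = I ◁ u ≫ a₁ →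
        ∃ f : I ⊗ W ⟶ Z, I ◁ w₀ ≫ f = a₀ ∧ I ◁ w₁ ≫ f = a₁ ∧ I ◁ wI ≫ f = aI := by
  obtain ⟨W, w, u', v', hw, h1, h2, h3⟩ := hS.exists_isPushout hunion (hS.whiskerRight hk Y)
    (hS.whiskerLeft I hu) (isPullback_whiskerLeft_whiskerRight k u)
  -- The product with `I` is a left adjoint, hence preserves the pushout.
  have h4 : IsPushout (I ◁ P ◁ u) (I ◁ k ▷ X) (I ◁ u') (I ◁ v') := h3.map (tensorLeft I)
  refine ⟨W, w, atPoint i Y ≫ u', atPoint j Y ≫ u', v', hw, ?_, ?_, h2, ?_, ?_⟩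
  · rw [Category.assoc, h1, atPoint_comp_whiskerRight]
  · rw [Category.assoc, h1, atPoint_comp_whiskerRight]
  · intro Z f g hf₀ hf₁ hfI
    refine h4.hom_ext (whiskerLeft_tensor_coproduct_hom_ext hc ?_ ?_) hfI
    · simpa using hf₀
    · simpa using hf₁
  · intro Z a₀ a₁ aI h₀ h₁
    obtain ⟨c, hc₀, hc₁⟩ := exists_whiskerLeft_tensor_coproduct_desc hc a₀ a₁
    obtain ⟨f, hf₁, hf₂⟩ := h4.exists_desc c aI (by
      refine whiskerLeft_tensor_coproduct_hom_ext hc ?_ ?_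
      · rw [← whiskerLeft_comp_assoc, atPoint_naturality, whiskerLeft_comp_assoc, hc₀, ← h₀,
          ← whiskerLeft_comp_assoc, atPoint_comp_whiskerRight]
      · rw [← whiskerLeft_comp_assoc, atPoint_naturality, whiskerLeft_comp_assoc, hc₁, ← h₁,
          ← whiskerLeft_comp_assoc, atPoint_comp_whiskerRight])
    refine ⟨f, ?_, ?_, hf₂⟩
    · rw [whiskerLeft_comp_assoc, hf₁, hc₀]
    · rw [whiskerLeft_comp_assoc, hf₁, hc₁]

end Boundary

end Boxes

variable {E : Type u} [Category.{v} E] [CartesianMonoidalCategory E]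

lemma exists_of_retractArrow {X Y Z W : E} {f : X ⟶ Y} {g : Z ⟶ W} (r : RetractArrow f g) :
    ∃ (i : X ⟶ Z) (i' : Y ⟶ W) (s : Z ⟶ X) (s' : W ⟶ Y), i ≫ g = f ≫ i' ∧ s ≫ f = g ≫ s' ∧
      i ≫ s = 𝟙 X ∧ i' ≫ s' = 𝟙 Y :=
  ⟨r.i.left, r.i.right, r.r.left, r.r.right, r.i_w, r.r_w, r.retract_left, r.retract_right⟩

/-! ### Homotopies and closure under retracts. -/

section Homotopies

variable {J : IntervalObject E}

lemma IntervalObject.Homotopic.refl {B A : E} (f : B ⟶ A) : J.Homotopic f f :=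
  ⟨snd _ _ ≫ f, (atPoint_snd_assoc J.d0 B f).symm, (atPoint_snd_assoc J.d1 B f).symm⟩

lemma IntervalObject.Homotopic.postcomp {B A A' : E} {f g : B ⟶ A} (h : J.Homotopic f g)
    (k : A ⟶ A') : J.Homotopic (f ≫ k) (g ≫ k) := by
  obtain ⟨H, rfl, rfl⟩ := h
  exact ⟨H ≫ k, by simp, by simp⟩

lemma IntervalObject.Homotopic.precomp {B B' A : E} {f g : B ⟶ A} (h : J.Homotopic f g)
    (k : B' ⟶ B) : J.Homotopic (k ≫ f) (k ≫ g) := by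
  obtain ⟨H, rfl, rfl⟩ := h
  exact ⟨J.I ◁ k ≫ H, (atPoint_naturality_assoc J.d0 k H).symm,
    (atPoint_naturality_assoc J.d1 k H).symm⟩

instance : J.homotopyEquivalences.IsStableUnderRetracts where
  of_retract {X Y Z W f g} r hg := by
    obtain ⟨i, i', s, s', e₁, e₂, h₁, h₂⟩ := exists_of_retractArrow r
    obtain ⟨k, hk₁, hk₂⟩ := hg
    refine ⟨i' ≫ k ≫ s, ?_, ?_⟩
    · have h := (hk₁.precomp i).postcomp s
      rwa [Category.comp_id, h₁, Category.assoc, Category.assoc, reassoc_of% e₁] at h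
    · have h := (hk₂.precomp i').postcomp s'
      rwa [Category.comp_id, h₂, Category.assoc, Category.assoc, ← e₂, ← Category.assoc k,
        ← Category.assoc i'] at h

end Homotopies

/-- A retract of a monomorphism is its pullback along the section between the codomains. -/
lemma IsDominance.isStableUnderRetracts {S : MorphismProperty E} (hS : IsDominance S) :
    S.IsStableUnderRetracts where
  of_retract {X Y Z W f g} r hg := by
    have := hS.pullback
    have : Mono g := hS.mono _ hg
    obtain ⟨i, i', s, s', e₁, e₂, h₁, h₂⟩ := exists_of_retractArrow r
    have key : ∀ ⦃V : E⦄ (a : V ⟶ Z) (b : V ⟶ Y), a ≫ g = b ≫ i' → (a ≫ s) ≫ f = b := by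
      intro V a b hab
      rw [Category.assoc, e₂, reassoc_of% hab, h₂, Category.comp_id]
    refine S.of_isPullback (f' := i) (g := g) (f := i') ?_ hg
    refine IsPullback.of_isLimit' ⟨e₁⟩ (PullbackCone.IsLimit.mk _
      (fun c ↦ c.fst ≫ s) (fun c ↦ ?_) (fun c ↦ key _ _ c.condition) (fun c l h3 _ ↦ ?_))
    · rw [← cancel_mono g, Category.assoc, e₁, ← Category.assoc, key _ _ c.condition, c.condition]
    · rw [← h3, Category.assoc, h₁, Category.comp_id]

/-- The assumptions on the class `S` of cofibrations. -/
structure IsCofibrationClass (J : IntervalObject E) (S : MorphismProperty E) : Prop where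
  dominance : IsDominance S
  union : IsClosedUnderFiniteUnions S
  incl : S J.incl

lemma BoxLift.extend {I : E} {d : 𝟙_ E ⟶ I} {S : MorphismProperty E} {Z : E}
    (h : BoxLift d S (toUnit Z)) {X Y : E} {u : X ⟶ Y} (hu : S u) (a : I ⊗ X ⟶ Z) (b : Y ⟶ Z)
    (hab : atPoint d X ≫ a = u ≫ b) : ∃ l : I ⊗ Y ⟶ Z, I ◁ u ≫ l = a ∧ atPoint d Y ≫ l = b := by
  obtain ⟨l, h1, h2, -⟩ := h u hu a b (toUnit _) hab (toUnit_unique _ _) (toUnit_unique _ _)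
  exact ⟨l, h1, h2⟩

/-! ### Homotopy in fibrant objects and the lifting properties. -/

namespace IsCofibrationClass

variable [HasFiniteLimits E] [MonoidalClosed E] [HasSubobjectClassifier E]
  {J : IntervalObject E} {S : MorphismProperty E}

/-- The coproduct `1 + 1`, with its inclusions typed as maps out of the unit. -/
def isColimitEnds (J : IntervalObject E) : IsColimit
    (BinaryCofan.mk (J.ends.inl : 𝟙_ E ⟶ J.ends.pt) (J.ends.inr : 𝟙_ E ⟶ J.ends.pt)) :=
  J.isColimit.ofIsoColimit (isoBinaryCofanMk _)

lemma d0 (h : IsCofibrationClass J S) : S J.d0 :=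
  have := h.dominance.comp
  S.comp_mem _ _ (h.dominance.inl h.union (isColimitEnds J)) h.incl

lemma d1 (h : IsCofibrationClass J S) : S J.d1 :=
  have := h.dominance.comp
  S.comp_mem _ _ (h.dominance.inl h.union (BinaryCofan.isColimitFlip
    (c := BinaryCofan.mk _ _) (isColimitEnds J))) h.incl

lemma fibrations_iff (h : IsCofibrationClass J S) {X Y : E} (p : X ⟶ Y) :
    J.fibrations S p ↔ BoxLift J.d0 S p ∧ BoxLift J.d1 S p := by
  constructor
  · intro hp
    exact ⟨boxLift_of_hasLiftingProperty h.dominance h.union h.d0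
        fun _ _ u hu sq ↦ hp _ (.zero u hu sq),
      boxLift_of_hasLiftingProperty h.dominance h.union h.d1
        fun _ _ u hu sq ↦ hp _ (.one u hu sq)⟩
  · rintro ⟨h0, h1⟩ A B i (⟨u, hu, sq⟩ | ⟨u, hu, sq⟩)
    · exact h0.hasLiftingProperty hu sq
    · exact h1.hasLiftingProperty hu sq

lemma fibrations_of_rlp (h : IsCofibrationClass J S) {X Y : E} {p : X ⟶ Y} (hp : S.rlp p) :
    J.fibrations S p :=
  (h.fibrations_iff p).2 ⟨boxLift_of_rlp h.dominance h.union h.d0 hp,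
    boxLift_of_rlp h.dominance h.union h.d1 hp⟩

lemma fibrant_of_fibrations {X Y : E} {p : X ⟶ Y} (hp : J.fibrations S p) (hY : J.fibrant S Y) :
    J.fibrant S X := by
  have : J.fibrations S (p ≫ toUnit Y) := (J.LeibnizMaps S).rlp.comp_mem _ _ hp hY
  rwa [comp_toUnit] at this

lemma boxLift (h : IsCofibrationClass J S) {X : E} (hX : J.fibrant S X) :
    BoxLift J.d0 S (toUnit X) :=
  ((h.fibrations_iff _).1 hX).1

/-- Two-dimensional open boxes in a fibrant object, relative to a map in `S`, can be filled. -/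
lemma exists_filling (h : IsCofibrationClass J S) {d : 𝟙_ E ⟶ J.I} {Z : E}
    (hZ : BoxLift d S (toUnit Z)) {X Y : E} {u : X ⟶ Y} (hu : S u)
    (a₀ a₁ b : J.I ⊗ Y ⟶ Z) (aI : J.I ⊗ (J.I ⊗ X) ⟶ Z)
    (h₀ : J.I ◁ atPoint J.d0 X ≫ aI = J.I ◁ u ≫ a₀)
    (h₁ : J.I ◁ atPoint J.d1 X ≫ aI = J.I ◁ u ≫ a₁)
    (h₀b : atPoint d Y ≫ a₀ = atPoint J.d0 Y ≫ b)
    (h₁b : atPoint d Y ≫ a₁ = atPoint J.d1 Y ≫ b)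
    (hIb : atPoint d (J.I ⊗ X) ≫ aI = J.I ◁ u ≫ b) :
    ∃ l : J.I ⊗ (J.I ⊗ Y) ⟶ Z, J.I ◁ atPoint J.d0 Y ≫ l = a₀ ∧
      J.I ◁ atPoint J.d1 Y ≫ l = a₁ ∧ J.I ◁ J.I ◁ u ≫ l = aI ∧
      atPoint d (J.I ⊗ Y) ≫ l = b := by
  obtain ⟨W, w, w₀, w₁, wI, hw, hw₀, hw₁, hwI, hext, hdesc⟩ :=
    exists_boundary h.dominance h.union (isColimitEnds J) h.incl hu
  change w₀ ≫ w = atPoint J.d0 Y at hw₀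
  change w₁ ≫ w = atPoint J.d1 Y at hw₁
  obtain ⟨c, hc₀, hc₁, hcI⟩ := hdesc a₀ a₁ aI h₀ h₁
  have hext' : ∀ f g : W ⟶ Z, w₀ ≫ f = w₀ ≫ g → w₁ ≫ f = w₁ ≫ g → wI ≫ f = wI ≫ g → f = g := by
    intro f g e₀ e₁ eI
    -- Joint epimorphy is known only after taking the product with I; it descends by restricting
    -- along the inclusion at `d`.
    have := hext (snd _ _ ≫ f) (snd _ _ ≫ g) (by simp [e₀]) (by simp [e₁]) (by simp [eI])
    simpa using congr(atPoint d W ≫ $this)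
  obtain ⟨l, hl₁, hl₂⟩ := hZ.extend hw c b (by
    apply hext'
    · rw [← atPoint_naturality_assoc, hc₀, h₀b, ← hw₀, Category.assoc]
    · rw [← atPoint_naturality_assoc, hc₁, h₁b, ← hw₁, Category.assoc]
    · rw [← atPoint_naturality_assoc, hcI, hIb, ← hwI, Category.assoc])
  refine ⟨l, ?_, ?_, ?_, hl₂⟩
  · rw [← hw₀, whiskerLeft_comp_assoc, hl₁, hc₀]
  · rw [← hw₁, whiskerLeft_comp_assoc, hl₁, hc₁]
  · rw [← hwI, whiskerLeft_comp_assoc, hl₁, hcI]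

/-- Fill the square with sides the homotopies f ≃ g and f ≃ k and constant base f; the lid is a
homotopy g ≃ k. Together with reflexivity this gives symmetry and transitivity. -/
lemma homotopic_euclidean (h : IsCofibrationClass J S) {A B : E} (hA : J.fibrant S A)
    {f g k : B ⟶ A} (hfg : J.Homotopic f g) (hfk : J.Homotopic f k) : J.Homotopic g k := by
  obtain ⟨H, hH₀, rfl⟩ := hfg
  obtain ⟨K, hK₀, rfl⟩ := hfk
  change f = atPoint J.d0 B ≫ H at hH₀
  change f = atPoint J.d0 B ≫ K at hK₀
  -- The filling is taken relative to the void subobject, which makes the compatibility conditions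
  -- along `u` trivial.
  obtain ⟨O, hO⟩ := exists_isVoid E
  obtain ⟨u⟩ := hO.exists_hom B
  have hO' := hO.of_hom (snd J.I O)
  have hO'' := hO'.of_hom (snd J.I (J.I ⊗ O))
  obtain ⟨aI⟩ := hO''.exists_hom A
  obtain ⟨l, hl₀, hl₁, -, hl⟩ := h.exists_filling (h.boxLift hA) (h.dominance.of_isVoid h.union hO u)
    H K (snd _ _ ≫ f) aI (hO'.hom_ext _ _) (hO'.hom_ext _ _) (by simp [← hH₀])
    (by simp [← hK₀]) (hO'.hom_ext _ _)
  refine ⟨atPoint J.d1 (J.I ⊗ B) ≫ l, ?_, ?_⟩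
  · change atPoint J.d1 B ≫ H = atPoint J.d0 B ≫ _
    rw [← hl₀, atPoint_naturality_assoc]
  · change atPoint J.d1 B ≫ K = atPoint J.d1 B ≫ _
    rw [← hl₁, atPoint_naturality_assoc]

lemma homotopic_symm (h : IsCofibrationClass J S) {A B : E} (hA : J.fibrant S A)
    {f g : B ⟶ A} (hfg : J.Homotopic f g) : J.Homotopic g f :=
  h.homotopic_euclidean hA hfg (.refl f)

lemma homotopic_trans (h : IsCofibrationClass J S) {A B : E} (hA : J.fibrant S A)
    {f g k : B ⟶ A} (hfg : J.Homotopic f g) (hgk : J.Homotopic g k) : J.Homotopic f k :=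
  h.homotopic_euclidean hA (h.homotopic_symm hA hfg) hgk

lemma homotopyEquivalences_comp (h : IsCofibrationClass J S) {X Y Z : E} (hX : J.fibrant S X)
    (hZ : J.fibrant S Z) {f : X ⟶ Y} {g : Y ⟶ Z} (hf : J.homotopyEquivalences f)
    (hg : J.homotopyEquivalences g) : J.homotopyEquivalences (f ≫ g) := by
  obtain ⟨f', hf₁, hf₂⟩ := hf
  obtain ⟨g', hg₁, hg₂⟩ := hg
  refine ⟨g' ≫ f', h.homotopic_trans hX ?_ hf₁, h.homotopic_trans hZ ?_ hg₂⟩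
  · simpa using (hg₁.precomp f).postcomp f'
  · simpa using (hf₂.precomp g').postcomp g

lemma homotopyEquivalences_of_precomp (h : IsCofibrationClass J S) {X Y Z : E}
    (hY : J.fibrant S Y) {f : X ⟶ Y} {g : Y ⟶ Z} (hf : J.homotopyEquivalences f)
    (hfg : J.homotopyEquivalences (f ≫ g)) : J.homotopyEquivalences g := by
  obtain ⟨f', hf₁, hf₂⟩ := hf
  obtain ⟨k, hk₁, hk₂⟩ := hfg
  refine ⟨k ≫ f, ?_, by simpa using hk₂⟩
  have e₁ := h.homotopic_symm hY (hf₂.postcomp (g ≫ k ≫ f))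
  have e₂ := (hk₁.precomp f').postcomp f
  simp only [Category.assoc, Category.id_comp, Category.comp_id] at e₁ e₂
  exact h.homotopic_trans hY e₁ (h.homotopic_trans hY e₂ hf₂)

lemma homotopyEquivalences_of_postcomp (h : IsCofibrationClass J S) {X Y Z : E}
    (hY : J.fibrant S Y) {f : X ⟶ Y} {g : Y ⟶ Z} (hg : J.homotopyEquivalences g)
    (hfg : J.homotopyEquivalences (f ≫ g)) : J.homotopyEquivalences f := by
  obtain ⟨g', hg₁, hg₂⟩ := hg
  obtain ⟨k, hk₁, hk₂⟩ := hfg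
  refine ⟨g ≫ k, by simpa using hk₁, ?_⟩
  have e₁ := h.homotopic_symm hY (hg₁.precomp (g ≫ k ≫ f))
  have e₂ := (hk₂.precomp g).postcomp g'
  simp only [Category.assoc, Category.comp_id] at e₁ e₂ ⊢
  exact h.homotopic_trans hY e₁ (h.homotopic_trans hY e₂ hg₁)

/-- A cofibration between fibrant objects that is a homotopy equivalence is the inclusion of a
strong deformation retract. -/
lemma exists_strongDeformationRetraction (h : IsCofibrationClass J S) {A B : E}
    (hA : J.fibrant S A) (hB : J.fibrant S B) {i : A ⟶ B} (hi : S i)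
    (hiw : J.homotopyEquivalences i) :
    ∃ (r : B ⟶ A) (G : J.I ⊗ B ⟶ B), i ≫ r = 𝟙 A ∧ atPoint J.d0 B ≫ G = r ≫ i ∧
      atPoint J.d1 B ≫ G = 𝟙 B ∧ J.I ◁ i ≫ G = snd _ _ ≫ i := by
  obtain ⟨g, ⟨K, hK₀, hK₁⟩, hgi⟩ := hiw
  -- Homotopy extension: the homotopy from gi to the identity of A extends along `i`, and its far
  -- end `r` is a strict retraction homotopic to `g`.
  obtain ⟨l, hl₁, hl₂⟩ := (h.boxLift hA).extend hi K g hK₀.symm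
  let r := atPoint J.d1 B ≫ l
  have hir : i ≫ r = 𝟙 A := by
    rw [← atPoint_naturality_assoc, hl₁]
    exact hK₁.symm
  have hgr : J.Homotopic g r := ⟨l, hl₂.symm, rfl⟩
  obtain ⟨H, hH₀, hH₁⟩ := h.homotopic_euclidean hB (hgr.postcomp i) hgi
  change r ≫ i = atPoint J.d0 B ≫ H at hH₀
  change 𝟙 B = atPoint J.d1 B ≫ H at hH₁
  -- To make the homotopy H from ri (first r, then i) to the identity stationary on A, compose the
  -- reverse of H restricted along ri with H: the box has these two homotopies as sides and constant
  -- base. On A the two sides agree, so the lid can be prescribed constant there.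
  obtain ⟨m, hm₀, hm₁, hmI, -⟩ := h.exists_filling (h.boxLift hB) hi
    (J.I ◁ (r ≫ i) ≫ H) H (snd _ _ ≫ r ≫ i) (J.I ◁ (snd _ _ ≫ i) ≫ H)
    (by
      simp only [← whiskerLeft_comp_assoc, atPoint_snd_assoc, reassoc_of% hir])
    (by
      simp only [← whiskerLeft_comp_assoc, atPoint_snd_assoc])
    (by
      rw [atPoint_naturality_assoc, ← hH₀, atPoint_snd_assoc, Category.assoc, reassoc_of% hir])
    (by rw [← hH₀, atPoint_snd_assoc])
    (by
      rw [atPoint_naturality_assoc, ← hH₀, whiskerLeft_snd_assoc, Category.assoc])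
  refine ⟨r, atPoint J.d1 (J.I ⊗ B) ≫ m, hir, ?_, ?_, ?_⟩
  · rw [← atPoint_naturality_assoc, hm₀, atPoint_naturality_assoc, ← hH₁, Category.comp_id]
  · rw [← atPoint_naturality_assoc, hm₁, ← hH₁]
  · rw [← atPoint_naturality_assoc, hmI, atPoint_naturality_assoc, ← hH₁, Category.comp_id]

/-- Over B, retract to A and apply `f`; this solves the problem up to the deformation G. Lift that
deformation along `p`, keeping it constant on A, and take its end. -/
lemma hasLiftingProperty_of_trivialCofibration (h : IsCofibrationClass J S) {A B : E}
    (hA : J.fibrant S A) (hB : J.fibrant S B) {i : A ⟶ B} (hi : S i)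
    (hiw : J.homotopyEquivalences i) {X Y : E} {p : X ⟶ Y} (hp : J.fibrations S p) :
    HasLiftingProperty i p := by
  obtain ⟨r, G, hir, hG₀, hG₁, hGi⟩ := h.exists_strongDeformationRetraction hA hB hi hiw
  refine ⟨fun {f g} sq ↦ ?_⟩
  have w := sq.w
  obtain ⟨l, hl₁, hl₂, hl₃⟩ := ((h.fibrations_iff p).1 hp).1 i hi (snd _ _ ≫ f) (r ≫ f) (G ≫ g)
    (by simp [reassoc_of% hir]) (by simp [w, reassoc_of% hGi]) (by simp [w, reassoc_of% hG₀])
  refine ⟨⟨⟨atPoint J.d1 B ≫ l, ?_, ?_⟩⟩⟩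
  · rw [← atPoint_naturality_assoc, hl₁, atPoint_snd_assoc]
  · rw [Category.assoc, hl₃, reassoc_of% hG₁]

/-- Trivial fibrations are homotopy equivalences. -/
lemma homotopyEquivalences_of_rlp (h : IsCofibrationClass J S) {X Y : E} {p : X ⟶ Y}
    (hp : S.rlp p) : J.homotopyEquivalences p := by
  obtain ⟨O, hO⟩ := exists_isVoid E
  obtain ⟨o⟩ := hO.exists_hom X
  -- Lifting against the void subobject of Y gives a section of `p`; the section after `p` agrees
  -- with the identity over Y, so the two are homotopic.
  have := hp (o ≫ p) (h.dominance.of_isVoid h.union hO _)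
  have sq : CommSq o (o ≫ p) p (𝟙 Y) := ⟨by simp⟩
  have hs : sq.lift ≫ p = 𝟙 Y := sq.fac_right
  refine ⟨sq.lift, ?_, by rw [hs]; exact .refl _⟩
  obtain ⟨H, hH₀, hH₁⟩ := exists_homotopy_of_rlp h.dominance (isColimitEnds J) h.incl hp
    (f := p ≫ sq.lift) (g := 𝟙 X) (by rw [Category.assoc, hs, Category.comp_id, Category.id_comp])
  exact ⟨H, hH₀.symm, hH₁.symm⟩

end IsCofibrationClass

/-! ### Path objects and the interchange of the two directions of a square. -/

section PathObject

variable [MonoidalClosed E] {I : E}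

/-- Evaluation of paths at a point of `I`. -/
def evalAt (d : 𝟙_ E ⟶ I) (Y : E) : (ihom I).obj Y ⟶ Y :=
  atPoint d _ ≫ (ihom.ev I).app Y

lemma comp_evalAt (d : 𝟙_ E ⟶ I) {V Y : E} (g : V ⟶ (ihom I).obj Y) :
    g ≫ evalAt d Y = atPoint d V ≫ MonoidalClosed.uncurry g := by
  rw [evalAt, MonoidalClosed.uncurry_eq, atPoint_naturality_assoc]

/-- The exchange of the first two factors. -/
def exchange (I V : E) : I ⊗ (I ⊗ V) ⟶ I ⊗ (I ⊗ V) :=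
  lift (snd _ _ ≫ fst _ _) (lift (fst _ _) (snd _ _ ≫ snd _ _))

lemma exchange_exchange (I V : E) : exchange I V ≫ exchange I V = 𝟙 _ := by
  ext <;> simp [exchange]

lemma exchange_exchange_assoc (I V : E) {Z : E} (g : I ⊗ (I ⊗ V) ⟶ Z) :
    exchange I V ≫ exchange I V ≫ g = g := by
  rw [← Category.assoc, exchange_exchange, Category.id_comp]

lemma atPoint_exchange (d : 𝟙_ E ⟶ I) (V : E) :
    atPoint d (I ⊗ V) ≫ exchange I V = I ◁ atPoint d V := by
  ext
  · simp [exchange]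
  · simp only [exchange, Category.assoc, lift_snd_assoc, lift_fst, atPoint_fst,
      whiskerLeft_snd_assoc]
    rw [← Category.assoc, comp_toUnit]
  · simp [exchange]

lemma atPoint_exchange_assoc (d : 𝟙_ E ⟶ I) (V : E) {Z : E} (g : I ⊗ (I ⊗ V) ⟶ Z) :
    atPoint d (I ⊗ V) ≫ exchange I V ≫ g = I ◁ atPoint d V ≫ g := by
  rw [← Category.assoc, atPoint_exchange]

lemma whiskerLeft_atPoint_exchange (d : 𝟙_ E ⟶ I) (V : E) :
    I ◁ atPoint d V ≫ exchange I V = atPoint d (I ⊗ V) := by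
  rw [← atPoint_exchange, Category.assoc, exchange_exchange, Category.comp_id]

lemma whiskerLeft_atPoint_exchange_assoc (d : 𝟙_ E ⟶ I) (V : E) {Z : E}
    (g : I ⊗ (I ⊗ V) ⟶ Z) :
    I ◁ atPoint d V ≫ exchange I V ≫ g = atPoint d (I ⊗ V) ≫ g := by
  rw [← Category.assoc, whiskerLeft_atPoint_exchange]

lemma exchange_naturality (I : E) {U V : E} (u : U ⟶ V) :
    I ◁ I ◁ u ≫ exchange I V = exchange I U ≫ I ◁ I ◁ u := by
  ext <;> simp [exchange]

lemma exchange_naturality_assoc (I : E) {U V Z : E} (u : U ⟶ V) (g : I ⊗ (I ⊗ V) ⟶ Z) :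
    I ◁ I ◁ u ≫ exchange I V ≫ g = exchange I U ≫ I ◁ I ◁ u ≫ g := by
  rw [← Category.assoc, exchange_naturality, Category.assoc]

end PathObject

/-! ### The mapping path object and the remaining factorisation. -/

namespace IsCofibrationClass

variable [HasFiniteLimits E] [MonoidalClosed E] [HasSubobjectClassifier E]
  {J : IntervalObject E} {S : MorphismProperty E}

/-- After transposition a lift is an extension of a partially given family of paths in Y with
prescribed starting points, which is a box filling. -/
lemma rlp_pullback_fst_evalAt (h : IsCofibrationClass J S) {X Y : E} (hY : J.fibrant S Y)
    (f : X ⟶ Y) : S.rlp (pullback.fst f (evalAt J.d0 Y)) := by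
  intro U V u hu
  refine ⟨fun {a b} sq ↦ ?_⟩
  obtain ⟨l, hl₁, hl₂⟩ := (h.boxLift hY).extend hu
    (MonoidalClosed.uncurry (a ≫ pullback.snd _ _)) (b ≫ f) (by
      rw [← comp_evalAt, Category.assoc, ← pullback.condition, reassoc_of% sq.w])
  have hl : b ≫ f = MonoidalClosed.curry l ≫ evalAt J.d0 Y := by
    rw [comp_evalAt, MonoidalClosed.uncurry_curry, hl₂]
  refine ⟨⟨⟨pullback.lift b (MonoidalClosed.curry l) hl, ?_, pullback.lift_fst _ _ _⟩⟩⟩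
  ext
  · rw [Category.assoc, pullback.lift_fst, sq.w]
  · rw [Category.assoc, pullback.lift_snd, ← MonoidalClosed.curry_natural_left, hl₁,
      MonoidalClosed.curry_uncurry]

/-- First lift the component in X. The path component is then a square in Y with its two ends
prescribed, by the image of that lift and by `c`, and with its face at `d` and its part over U
prescribed too: a two-dimensional box. `exchange` swaps the path direction with the lifting
direction. -/
lemma boxLift_pullback_snd_evalAt (h : IsCofibrationClass J S) {X Y : E} {d : 𝟙_ E ⟶ J.I}
    (hX : BoxLift d S (toUnit X)) (hY : BoxLift d S (toUnit Y)) (f : X ⟶ Y) :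
    BoxLift d S (pullback.snd f (evalAt J.d0 Y) ≫ evalAt J.d1 Y) := by
  intro U V u hu a b c hab hac hbc
  obtain ⟨x, hx₁, hx₂⟩ := hX.extend hu (a ≫ pullback.fst _ _) (b ≫ pullback.fst _ _)
    (by rw [reassoc_of% hab])
  obtain ⟨l, hl₀, hl₁, hlI, hlb⟩ := h.exists_filling hY hu (x ≫ f) c
    (MonoidalClosed.uncurry (b ≫ pullback.snd _ _))
    (exchange J.I U ≫ MonoidalClosed.uncurry (a ≫ pullback.snd _ _))
    (by rw [whiskerLeft_atPoint_exchange_assoc, ← comp_evalAt, reassoc_of% hx₁, Category.assoc,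
      pullback.condition])
    (by rw [whiskerLeft_atPoint_exchange_assoc, ← comp_evalAt, Category.assoc, hac])
    (by rw [reassoc_of% hx₂, ← comp_evalAt, Category.assoc, pullback.condition])
    (by rw [← hbc, ← comp_evalAt, Category.assoc])
    (by rw [atPoint_exchange_assoc, ← MonoidalClosed.uncurry_natural_left, reassoc_of% hab,
      MonoidalClosed.uncurry_natural_left])
  have hx : x ≫ f = MonoidalClosed.curry (exchange J.I V ≫ l) ≫ evalAt J.d0 Y := by
    rw [comp_evalAt, MonoidalClosed.uncurry_curry, atPoint_exchange_assoc, hl₀]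
  refine ⟨pullback.lift x (MonoidalClosed.curry (exchange J.I V ≫ l)) hx, ?_, ?_, ?_⟩
  · ext
    · rw [Category.assoc, pullback.lift_fst, hx₁]
    · rw [Category.assoc, pullback.lift_snd, ← MonoidalClosed.curry_natural_left,
        exchange_naturality_assoc, hlI, exchange_exchange_assoc, MonoidalClosed.curry_uncurry]
  · ext
    · rw [Category.assoc, pullback.lift_fst, hx₂]
    · rw [Category.assoc, pullback.lift_snd, ← MonoidalClosed.curry_natural_left,
        whiskerLeft_atPoint_exchange_assoc, hlb, MonoidalClosed.curry_uncurry]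
  · rw [pullback.lift_snd_assoc, comp_evalAt, MonoidalClosed.uncurry_curry,
      atPoint_exchange_assoc, hl₁]

/-- Every map between fibrant objects factors as a cofibration and homotopy equivalence followed by
a fibration. -/
lemma exists_trivialCofibration_fibration (h : IsCofibrationClass J S) {X Y : E}
    (hX : J.fibrant S X) (hY : J.fibrant S Y) (f : X ⟶ Y) :
    ∃ (Z : E) (i : X ⟶ Z) (p : Z ⟶ Y), S i ∧ J.homotopyEquivalences i ∧ J.fibrations S p ∧
      i ≫ p = f := by
  have hX' := (h.fibrations_iff _).1 hX
  have hY' := (h.fibrations_iff _).1 hY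
  let q := pullback.snd f (evalAt J.d0 Y) ≫ evalAt J.d1 Y
  have hq : J.fibrations S q := (h.fibrations_iff _).2
    ⟨h.boxLift_pullback_snd_evalAt hX'.1 hY'.1 f, h.boxLift_pullback_snd_evalAt hX'.2 hY'.2 f⟩
  have hP := fibrant_of_fibrations hq hY
  have hconst : ∀ d : 𝟙_ E ⟶ J.I,
      (f ≫ MonoidalClosed.curry (snd J.I Y)) ≫ evalAt d Y = f := by
    intro d
    rw [Category.assoc, comp_evalAt, MonoidalClosed.uncurry_curry, atPoint_snd, Category.comp_id]
  -- The constant paths: a section of the projection to X, which is a trivial fibration, so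
  -- 2-out-of-3 makes it a homotopy equivalence.
  let j : X ⟶ pullback f (evalAt J.d0 Y) :=
    pullback.lift (𝟙 X) (f ≫ MonoidalClosed.curry (snd J.I Y)) (by
      rw [hconst, Category.id_comp])
  have hjq : j ≫ q = f := by
    rw [pullback.lift_snd_assoc, hconst]
  have hj : J.homotopyEquivalences j := by
    refine h.homotopyEquivalences_of_postcomp hP
      (h.homotopyEquivalences_of_rlp (h.rlp_pullback_fst_evalAt hY f)) ?_
    rw [pullback.lift_fst]
    exact ⟨𝟙 X, by simpa using .refl _, by simpa using .refl _⟩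
  -- Nothing puts `j` itself in `S`, so it is replaced by its cofibration part, again a homotopy
  -- equivalence by 2-out-of-3.
  obtain ⟨Z, i, p, hi, hp, hip⟩ := h.dominance.exists_factorization j
  have hpf := h.fibrations_of_rlp hp
  refine ⟨Z, i, p ≫ q, hi, ?_, (J.LeibnizMaps S).rlp.comp_mem _ _ hpf hq, by
    rw [reassoc_of% hip, hjq]⟩
  exact h.homotopyEquivalences_of_postcomp (fibrant_of_fibrations hpf hP)
    (h.homotopyEquivalences_of_rlp hp) (hip ▸ hj)

/-- A fibration between fibrant objects that is a homotopy equivalence has the right lifting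
property against cofibrations. -/
lemma rlp_of_trivialFibration (h : IsCofibrationClass J S) {X Y : E}
    (hX : J.fibrant S X) (hY : J.fibrant S Y) {p : X ⟶ Y} (hp : J.fibrations S p)
    (hpw : J.homotopyEquivalences p) : S.rlp p := by
  -- Retract argument: by 2-out-of-3 `i` is a trivial cofibration, so `p` lifts against it and is a
  -- retract of `q`.
  obtain ⟨Z, i, q, hi, hq, hiq⟩ := h.dominance.exists_factorization p
  have hZ := fibrant_of_fibrations (h.fibrations_of_rlp hq) hY
  have := h.hasLiftingProperty_of_trivialCofibration hX hZ hi
    (h.homotopyEquivalences_of_postcomp hZ (h.homotopyEquivalences_of_rlp hq) (hiq.symm ▸ hpw)) hp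
  exact MorphismProperty.of_retract (RetractArrow.ofRightLiftingProperty hiq) hq

end IsCofibrationClass

end IntervalModel

/-! ### Assembly of the model structure on the fibrant objects. -/

open IntervalModel in
theorem mainTheorem1 {E : Type u} [Category.{v} E] [CartesianMonoidalCategory E]
    [HasFiniteLimits E] [MonoidalClosed E] [HasSubobjectClassifier E]
    (J : IntervalModel.IntervalObject E) (S : MorphismProperty E)
    (hS : IntervalModel.IsDominance S)
    (hunion : IntervalModel.IsClosedUnderFiniteUnions S)
    (hends : S J.incl) :
    IntervalModel.IsQuillenModelStructure (D := (J.fibrant S).FullSubcategory)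
      (S.inverseImage (J.fibrant S).ι)
      ((J.fibrations S).inverseImage (J.fibrant S).ι)
      (J.homotopyEquivalences.inverseImage (J.fibrant S).ι) := by
  have h : IsCofibrationClass J S := ⟨hS, hunion, hends⟩
  have := hS.isStableUnderRetracts
  have : (J.fibrations S).IsStableUnderRetracts :=
    inferInstanceAs (J.LeibnizMaps S).rlp.IsStableUnderRetracts
  have lift : ∀ {A B X Y : (J.fibrant S).FullSubcategory} (i : A ⟶ B) (p : X ⟶ Y),
      HasLiftingProperty i.hom p.hom → HasLiftingProperty i p := by
    intro A B X Y i p _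
    refine ⟨fun {f g} sq ↦ ?_⟩
    have sq' : CommSq f.hom i.hom p.hom g.hom := sq.map (J.fibrant S).ι
    exact ⟨⟨⟨ObjectProperty.homMk sq'.lift, by ext; exact sq'.fac_left,
      by ext; exact sq'.fac_right⟩⟩⟩
  refine ⟨?_, ?_, ?_⟩
  · have : MorphismProperty.HasFactorization
        (S.inverseImage (J.fibrant S).ι ⊓ J.homotopyEquivalences.inverseImage (J.fibrant S).ι)
        ((J.fibrations S).inverseImage (J.fibrant S).ι) := ⟨fun {X Y} f ↦ by
      obtain ⟨Z, i, p, hi, hiw, hp, hip⟩ :=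
        h.exists_trivialCofibration_fibration X.property Y.property f.hom
      exact ⟨{ Z := ⟨Z, IsCofibrationClass.fibrant_of_fibrations hp Y.property⟩
               i := ObjectProperty.homMk i
               p := ObjectProperty.homMk p
               fac := by ext; exact hip
               hi := ⟨hi, hiw⟩
               hp := hp }⟩⟩
    -- For classes closed under retracts, factorisations and mutual lifting already yield a weak
    -- factorisation system.
    exact .mk' _ _ fun {A B X Y} i p hi hp ↦ lift i p
      (h.hasLiftingProperty_of_trivialCofibration A.property B.property hi.1 hi.2 hp)
  · have : MorphismProperty.HasFactorization (S.inverseImage (J.fibrant S).ι)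
        ((J.fibrations S).inverseImage (J.fibrant S).ι ⊓
          J.homotopyEquivalences.inverseImage (J.fibrant S).ι) := ⟨fun {X Y} f ↦ by
      obtain ⟨Z, i, p, hi, hp, hip⟩ := hS.exists_factorization f.hom
      have hpf := h.fibrations_of_rlp hp
      exact ⟨{ Z := ⟨Z, IsCofibrationClass.fibrant_of_fibrations hpf Y.property⟩
               i := ObjectProperty.homMk i
               p := ObjectProperty.homMk p
               fac := by ext; exact hip
               hi := hi
               hp := ⟨hpf, h.homotopyEquivalences_of_rlp hp⟩ }⟩⟩
    exact .mk' _ _ fun {A B X Y} i p hi hp ↦ lift i p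
      (h.rlp_of_trivialFibration X.property Y.property hp.1 hp.2 _ hi)
  · exact
      { comp_mem := fun {X Y Z} f g hf hg ↦
          h.homotopyEquivalences_comp X.property Z.property hf hg
        of_postcomp := fun {X Y Z} f g hg hfg ↦
          h.homotopyEquivalences_of_postcomp Y.property hg hfg
        of_precomp := fun {X Y Z} f g hf hfg ↦
          h.homotopyEquivalences_of_precomp Y.property hf hfg }
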